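/- Let $n\ge 0$ be an integer, let $P_0\mathbb{R}^n=\{\gamma\in C([0,\infty),\mathbb{R}^n):\gamma(0)=0\}$ carry the compact-open topology and its Borel $\sigma$-algebra, and let $\mathbb{P}_0$ be the Wiener measure on $P_0\mathbb{R}^n$, normalized so that its generator is $\Delta$. That is, for all $0<t_1<\dots<t_k$ the law of $(\gamma_{t_1},\dots,\gamma_{t_k})$ under $\mathbb{P}_0$ is $$\rho_{t_1}(0,y_1)\,\rho_{t_2-t_1}(y_1,y_2)\cdots\rho_{t_k-t_{k-1}}(y_{k-1},y_k)\,dy_1\cdots dy_k,\qquad \rho_t(x,y)=(4\pi t)^{-n/2}e^{-|x-y|^2/4t}.$$ Write $\mathbb{E}$ for the expectation with respect to $\mathbb{P}_0$. Let $\varphi\in H^1_0(\mathbb{R}^+)$, that is, $\varphi:[0,\infty)\to\mathbb{R}$ is locally absolutely continuous with $\varphi(0)=0$ and $\|\varphi\|^2:=\int_0^\infty|\dot\varphi(t)|^2\,dt<\infty$. For $v\in\mathbb{R}^n$ and $G:P_0\mathbb{R}^n\to\mathbb{R}$ put $$D_{\varphi v}G(\gamma)=\lim_{\varepsilon\to0}\frac{G(\gamma+\varepsilon\varphi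 v)-G(\gamma)}{\varepsilon}.$$ The $\varphi$-gradient $\nabla_\varphi F:P_0\mathbb{R}^n\to\mathbb{R}^n$ and the $\varphi$-Hessian $\mathrm{Hess}_\varphi F:P_0\mathbb{R}^n\to\mathbb{R}^{n\times n}$ of a function $F$ are defined by $$\langle\nabla_\varphi F(\gamma),v\rangle=D_{\varphi v}F(\gamma),\qquad \langle\mathrm{Hess}_\varphi F(\gamma),v\otimes w\rangle=D_{\varphi v}D_{\varphi w}F(\gamma)\qquad\text{for all }v,w\in\mathbb{R}^n,$$ and $\Delta_\varphi F=\mathrm{tr}(\mathrm{Hess}_\varphi F)$. **Theorem.** Let $F:P_0\mathbb{R}^n\to[0,\infty)$ be integrable with respect to $\mathbb{P}_0$ with $\mathbb{E}[F]>0$. Let $\varphi\in H^1_0(\mathbb{R}^+)$ be such that $\nabla_\varphi F$ and $\mathrm{Hess}_\varphi F$ exist at every $\gamma\in P_0\mathbb{R}^n$ and are integrable. Then the $n\times n$ matrix $$\frac{\mathbb{E}[\mathrm{Hess}_\varphi F]}{\mathbb{E}[F]}-\frac{\mathbb{E}[\nabla_\varphi F]\otimes\mathbb{E}[\nabla_\varphi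 F]}{\mathbb{E}[F]^2}+\frac12\|\varphi\|^2\,\mathrm{Id}$$ is symmetric and positive semidefinite. In particular, $$\frac{\mathbb{E}[\Delta_\varphi F]}{\mathbb{E}[F]}-\frac{|\mathbb{E}[\nabla_\varphi F]|^2}{\mathbb{E}[F]^2}+\frac n2\|\varphi\|^2\ge0.$$ -/

import Mathlib

open MeasureTheory
open scoped NNReal RealInnerProductSpace Matrix

/-- The space `P₀ℝⁿ` of continuous paths `γ : [0, ∞) → ℝⁿ` with `γ 0 = 0`, as a linear subspace of
all continuous maps. It carries the topology of locally uniform convergence (compact-open). -/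
def basedPaths (n : ℕ) : Submodule ℝ C(ℝ≥0, EuclideanSpace ℝ (Fin n)) where
  carrier := {γ | γ 0 = 0}
  add_mem' := by
    intro a b ha hb
    simp only [Set.mem_ofPred_eq] at ha hb
    simp [ha, hb]
  zero_mem' := by simp
  smul_mem' := by
    intro c a ha
    simp only [Set.mem_ofPred_eq] at ha
    simp [ha]

abbrev PathSpace (n : ℕ) : Type := basedPaths n

/-- Path space carries the Borel `σ`-algebra of the compact-open topology. -/
instance instMeasurableSpacePathSpace (n : ℕ) : MeasurableSpace (PathSpace n) :=
  borel (PathSpace n)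

instance instBorelSpacePathSpace (n : ℕ) : BorelSpace (PathSpace n) := ⟨rfl⟩

/-- The Euclidean heat kernel `ρ_t(x, y)` of `∂_t = Δ` (no factor `1/2`). -/
noncomputable def heatKernel (n : ℕ) (t : ℝ) (x y : EuclideanSpace ℝ (Fin n)) : ℝ :=
  (4 * Real.pi * t) ^ (-(n : ℝ) / 2) * Real.exp (-‖x - y‖ ^ 2 / (4 * t))

/-- The density at `(y₁, …, y_k)` of
`ρ_{t₁}(0, dy₁) ρ_{t₂ - t₁}(y₁, dy₂) ⋯ ρ_{t_k - t_{k-1}}(y_{k-1}, dy_k)`. -/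
noncomputable def heatKernelChain (n : ℕ) {k : ℕ} (t : Fin k → ℝ≥0)
    (y : Fin k → EuclideanSpace ℝ (Fin n)) : ℝ :=
  let t' : Fin (k + 1) → ℝ := Fin.cons 0 (fun i => (t i : ℝ))
  let y' : Fin (k + 1) → EuclideanSpace ℝ (Fin n) := Fin.cons 0 y
  ∏ i : Fin k, heatKernel n (t' i.succ - t' i.castSucc) (y' i.castSucc) (y' i.succ)

/-- `P` is the Wiener measure on `P₀ℝⁿ`: the law of `(γ_{t₁}, …, γ_{t_k})` under `P` is the chain of
heat kernel measures, for all `0 < t₁ < ⋯ < t_k`. These laws determine `P`;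
the case `k = 0` says that `P` has total mass one. -/
def IsWienerMeasure {n : ℕ} (P : Measure (PathSpace n)) : Prop :=
  ∀ (k : ℕ) (t : Fin k → ℝ≥0), (∀ i, 0 < t i) → StrictMono t →
    P.map (fun γ : PathSpace n => fun i : Fin k => γ.1 (t i)) =
      (volume : Measure (Fin k → EuclideanSpace ℝ (Fin n))).withDensity
        (fun y => ENNReal.ofReal (heatKernelChain n t y))

/-- The functions of class `H¹₀` on `[0, ∞)`: locally absolutely continuous, zero at `0`, with
square integrable derivative. Only the values of `toFun` on `[0, ∞)` matter. -/
structure HOneZero where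
  toFun : ℝ → ℝ
  map_zero : toFun 0 = 0
  absCont : ∀ T : ℝ, 0 < T → AbsolutelyContinuousOnInterval toFun 0 T
  deriv_memLp : MemLp (deriv toFun) 2 (volume.restrict (Set.Ioi (0 : ℝ)))

namespace HOneZero

/-- `‖φ‖² = ∫₀^∞ |φ'(t)|² dt`. -/
noncomputable def normSq (φ : HOneZero) : ℝ :=
  ∫ t in Set.Ioi (0 : ℝ), (deriv φ.toFun t) ^ 2

theorem continuous_restrict (φ : HOneZero) : Continuous (fun t : ℝ≥0 => φ.toFun t) := by
  rw [continuous_iff_continuousAt]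
  intro t
  have hT : (0 : ℝ) < (t : ℝ) + 1 := by positivity
  have h := (φ.absCont _ hT).continuousOn
  rw [Set.uIcc_of_le hT.le] at h
  have h2 : ContinuousOn (fun s : ℝ≥0 => φ.toFun s) (Set.Iio (t + 1)) := by
    refine h.comp NNReal.continuous_coe.continuousOn ?_
    intro s hs
    have hs' : (s : ℝ) < ((t + 1 : ℝ≥0) : ℝ) := NNReal.coe_lt_coe.2 hs
    rw [NNReal.coe_add, NNReal.coe_one] at hs'
    exact ⟨s.2, hs'.le⟩
  exact h2.continuousAt (isOpen_Iio.mem_nhds (by simp))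

/-- The path `t ↦ φ(t) v`, a direction in path space. -/
noncomputable def path {n : ℕ} (φ : HOneZero) (v : EuclideanSpace ℝ (Fin n)) : PathSpace n :=
  ⟨⟨fun t : ℝ≥0 => φ.toFun t • v, φ.continuous_restrict.smul continuous_const⟩, by
    change φ.toFun ((0 : ℝ≥0) : ℝ) • v = 0
    simp [φ.map_zero]⟩

end HOneZero

/-- The `φ`-gradient `∇_φ F`, with coordinates
`⟪∇_φ F(γ), eᵢ⟫ = D_{φ eᵢ} F(γ) = lim_{ε → 0} (F(γ + ε φ eᵢ) - F(γ)) / ε`. -/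
noncomputable def phiGradient {n : ℕ} (F : PathSpace n → ℝ) (φ : HOneZero) (γ : PathSpace n) :
    EuclideanSpace ℝ (Fin n) :=
  WithLp.toLp 2 fun i => lineDeriv ℝ F γ (φ.path (EuclideanSpace.single i 1))

/-- The `φ`-Hessian `Hess_φ F`, with entries `⟪Hess_φ F, eᵢ ⊗ eⱼ⟫ = D_{φ eᵢ} D_{φ eⱼ} F`. -/
noncomputable def phiHessian {n : ℕ} (F : PathSpace n → ℝ) (φ : HOneZero) (γ : PathSpace n) :
    Matrix (Fin n) (Fin n) ℝ :=
  Matrix.of fun i j =>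
    lineDeriv ℝ (fun η => lineDeriv ℝ F η (φ.path (EuclideanSpace.single j 1))) γ
      (φ.path (EuclideanSpace.single i 1))

/-- The `φ`-Laplacian `Δ_φ F = tr (Hess_φ F)`. -/
noncomputable def phiLaplacian {n : ℕ} (F : PathSpace n → ℝ) (φ : HOneZero) (γ : PathSpace n) : ℝ :=
  (phiHessian F φ γ).trace

/-- The `φ`-gradient of `F` exists on all of path space: for every `γ` and every `v` the limit
`D_{φ v} F(γ)` exists and equals `⟪∇_φ F(γ), v⟫`. -/
def HasPhiGradient {n : ℕ} (F : PathSpace n → ℝ) (φ : HOneZero) : Prop :=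
  ∀ (γ : PathSpace n) (v : EuclideanSpace ℝ (Fin n)),
    HasLineDerivAt ℝ F ⟪phiGradient F φ γ, v⟫ γ (φ.path v)

/-- The `φ`-Hessian of `F` exists on all of path space: for every `γ` and all `v`, `w` the limit
`D_{φ v} D_{φ w} F(γ)` exists and equals `⟪Hess_φ F(γ), v ⊗ w⟫`. -/
def HasPhiHessian {n : ℕ} (F : PathSpace n → ℝ) (φ : HOneZero) : Prop :=
  ∀ (γ : PathSpace n) (v w : EuclideanSpace ℝ (Fin n)),
    HasLineDerivAt ℝ (fun η => lineDeriv ℝ F η (φ.path w))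
      (v.ofLp ⬝ᵥ (phiHessian F φ γ *ᵥ w.ofLp)) γ (φ.path v)

/-- The entrywise expectation of a random matrix. -/
noncomputable def matrixExpectation {n : ℕ} (P : Measure (PathSpace n))
    (H : PathSpace n → Matrix (Fin n) (Fin n) ℝ) : Matrix (Fin n) (Fin n) ℝ :=
  Matrix.of fun i j => ∫ γ, H γ i j ∂P

/-!
The matrix in the theorem is a covariance matrix. Let `Xᵢ = ½ ∫₀^∞ φ' dγⁱ` be the Paley–Wiener
integral of `φ` in the `i`-th coordinate. Under Wiener measure `Xᵢ` is Gaussian with variance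
`c = ½ ‖φ‖²`, it grows at the constant rate `c δᵢⱼ` along `φ eⱼ`, and integration by parts reads
`𝔼[D_{φ eᵢ} G] = 𝔼[G Xᵢ]`. Applied to `F` it gives `𝔼[∇_φ F]ᵢ = 𝔼[F Xᵢ]`; applied to `D_{φ eⱼ} F`
and then to `F Xᵢ` it gives `𝔼[Hess_φ F]ᵢⱼ = 𝔼[F Xᵢ Xⱼ] - c δᵢⱼ 𝔼[F]`
(`IsWienerMeasure.integrable_and_integral_mul_paleyWiener_mul`). Hence the matrix is the covariance
matrix of `(X₁, …, Xₙ)` under the probability measure `F dℙ₀ / 𝔼[F]`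
(`posSemidef_covariance_of_weight`), and the scalar inequality is the sign of its trace.

Integration by parts (`IsWienerMeasure.integrable_and_integral_mul_paleyWiener`) rests on the
Cameron–Martin theorem in disintegrated form
(`IsWienerMeasure.measurePreserving_paleyWiener_residual`): if `c ≠ 0`, then `Xᵢ` is independent of
`γ - (Xᵢ / c) φ eᵢ`, so that Wiener measure is the image of a product with a one-dimensional
Gaussian factor in the direction `φ eᵢ`. On that factor the identity is Stein's. As `G` and
`D_{φ eᵢ} G` are only assumed integrable, the integrability of `G Xᵢ` is part of the claim; it
follows from a one-dimensional estimate (`integral_abs_id_mul_gaussianReal_le`) that is uniform in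
the other factor.

Independence is read off characteristic functions. The increments of the path are independent
Gaussians because passing to increments preserves Lebesgue measure and turns the chain of heat
kernels into a product; this gives the characteristic functions of all finite-dimensional marginals
(`IsWienerMeasure.integral_cexp_pathPairing`), with variances expressed by norms of step functions
in `L²(0, ∞)`. Step functions are dense there, `Xᵢ` is an almost sure limit of functionals of
finitely many values of the path, and the joint characteristic function of `Xᵢ` and any such
functional follows in the limit. Measures on the Polish space `ℝ × P₀ℝⁿ` are determined by these
functions.
-/

/-! ### Gaussian integration by parts on the line -/

section Stein

open ProbabilityTheory Filter

theorem hasDerivAt_gaussianPDFReal_zero (v : ℝ≥0) (x : ℝ) :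
    HasDerivAt (gaussianPDFReal 0 v) (-(x / v) * gaussianPDFReal 0 v x) x := by
  have h : HasDerivAt (fun x : ℝ => -(x - 0) ^ 2 / (2 * (v : ℝ))) (-(x / v)) x := by
    have := (((hasDerivAt_id x).sub_const 0).pow 2).neg.div_const (2 * (v : ℝ))
    refine this.congr_deriv ?_
    simp only [id, sub_zero]
    push_cast
    rcases eq_or_ne (v : ℝ) 0 with h0 | h0
    · simp [h0]
    · field_simp
  have := (h.exp).const_mul (√(2 * Real.pi * v))⁻¹
  rw [gaussianPDFReal_def]
  refine this.congr_deriv ?_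
  ring

theorem integrable_gaussianReal_iff {v : ℝ≥0} (hv : v ≠ 0) (f : ℝ → ℝ) :
    Integrable f (gaussianReal 0 v) ↔ Integrable (fun x => gaussianPDFReal 0 v x * f x) := by
  rw [gaussianReal_of_var_ne_zero 0 hv,
    integrable_withDensity_iff_integrable_smul' (measurable_gaussianPDF 0 v)
      (ae_of_all _ fun x => gaussianPDF_lt_top)]
  simp [toReal_gaussianPDF]

theorem sqrt_one_add_sq_pos (y : ℝ) : 0 < √(1 + y ^ 2) := Real.sqrt_pos.2 (by positivity)

theorem abs_le_sqrt_one_add_sq (y : ℝ) : |y| ≤ √(1 + y ^ 2) := by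
  refine Real.abs_le_sqrt (by linarith)

theorem sqrt_one_add_sq_le (y : ℝ) : √(1 + y ^ 2) ≤ 1 + |y| := by
  refine Real.sqrt_le_iff.2 ⟨by positivity, ?_⟩
  nlinarith [sq_abs y, abs_nonneg y]

theorem one_le_sqrt_one_add_sq (y : ℝ) : 1 ≤ √(1 + y ^ 2) := by
  rw [Real.one_le_sqrt]; nlinarith [sq_nonneg y]

theorem hasDerivAt_sqrt_one_add_sq (y : ℝ) :
    HasDerivAt (fun y : ℝ => √(1 + y ^ 2)) (y / √(1 + y ^ 2)) y := by
  have h : HasDerivAt (fun y : ℝ => 1 + y ^ 2) (2 * y) y := by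
    simpa using ((hasDerivAt_id y).pow 2).const_add 1
  refine (h.sqrt (by positivity)).congr_deriv ?_
  field_simp

theorem hasDerivAt_div_sqrt_one_add_sq (y : ℝ) :
    HasDerivAt (fun y : ℝ => y / √(1 + y ^ 2)) (1 / √(1 + y ^ 2) ^ 3) y := by
  have h0 := (sqrt_one_add_sq_pos y).ne'
  refine ((hasDerivAt_id y).div (hasDerivAt_sqrt_one_add_sq y) h0).congr_deriv ?_
  have h1 : √(1 + y ^ 2) ^ 2 = 1 + y ^ 2 := Real.sq_sqrt (by positivity)
  simp only [id]
  field_simp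
  rw [h1]; ring

theorem abs_div_sqrt_one_add_sq_le (y : ℝ) : |y / √(1 + y ^ 2)| ≤ 1 := by
  rw [abs_div, abs_of_pos (sqrt_one_add_sq_pos y), div_le_one (sqrt_one_add_sq_pos y)]
  exact abs_le_sqrt_one_add_sq y

theorem abs_le_mul_div_sqrt_add_one (x : ℝ) : |x| ≤ x * (x / √(1 + x ^ 2)) + 1 := by
  have h0 := sqrt_one_add_sq_pos x
  have h1 : √(1 + x ^ 2) ^ 2 = 1 + x ^ 2 := Real.sq_sqrt (by positivity)
  have h2 := abs_le_sqrt_one_add_sq x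
  have h3 := one_le_sqrt_one_add_sq x
  rw [← mul_div_assoc, ← sub_le_iff_le_add, le_div_iff₀ h0]
  nlinarith

variable {v : ℝ≥0} {g g' : ℝ → ℝ}

/-- The weight `x` costs nothing beyond the integrability of `g` and `g'`. The function
`√(1 + g²)`, weighted by the bounded odd factor `θ x = x / √(1 + x²)` and the density, is
integrated by parts over `[-R, R]`; the boundary terms have the favourable sign. -/
theorem intervalIntegral_abs_mul_gaussian_le (hv : v ≠ 0) (hg : ∀ x, HasDerivAt g (g' x) x)
    (hgi : Integrable g (gaussianReal 0 v)) (hg'i : Integrable g' (gaussianReal 0 v))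
    {R : ℝ} (hR : 0 ≤ R) :
    ∫ x in (-R)..R, ‖gaussianPDFReal 0 v x * (x * g x)‖ ≤
      (v + 1) * (1 + ∫ x, |g x| ∂gaussianReal 0 v) + v * ∫ x, |g' x| ∂gaussianReal 0 v := by
  set ρ := gaussianPDFReal 0 v with hρ
  set s : ℝ → ℝ := fun y => √(1 + y ^ 2) with hs
  set θ : ℝ → ℝ := fun y => y / √(1 + y ^ 2) with hθ
  have hvpos : (0 : ℝ) < v := by positivity
  have hρ0 : ∀ x, 0 ≤ ρ x := fun x => gaussianPDFReal_nonneg 0 v x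
  have hgc : Continuous g := continuous_iff_continuousAt.2 fun x => (hg x).continuousAt
  have hρc : Continuous ρ :=
    continuous_iff_continuousAt.2 fun x => (hasDerivAt_gaussianPDFReal_zero v x).continuousAt
  have hsc : Continuous s := by fun_prop
  have hs0 : ∀ y, s y ≠ 0 := fun y => (sqrt_one_add_sq_pos y).ne'
  have hs1 : ∀ y, 0 ≤ s y := fun y => (sqrt_one_add_sq_pos y).le
  have hθc : Continuous θ := continuous_id.div hsc hs0
  -- everything is expressed through integrals against Lebesgue measure
  have hi1 : Integrable (fun x => ρ x * (1 + |g x|)) :=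
    (integrable_gaussianReal_iff hv _).1 ((integrable_const 1).add hgi.abs)
  have hi2 : Integrable (fun x => ρ x * |g' x|) := (integrable_gaussianReal_iff hv _).1 hg'i.abs
  have hi3 : Integrable (fun x => ρ x * g' x) := (integrable_gaussianReal_iff hv _).1 hg'i
  have e1 : ∫ x, ρ x * (1 + |g x|) = 1 + ∫ x, |g x| ∂gaussianReal 0 v := by
    have := integral_gaussianReal_eq_integral_smul (μ := 0) (f := fun x => 1 + |g x|) hv
    simp only [smul_eq_mul] at this
    rw [hρ, ← this, integral_add (integrable_const 1) hgi.abs]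
    simp
  have e2 : ∫ x, ρ x * |g' x| = ∫ x, |g' x| ∂gaussianReal 0 v := by
    have := integral_gaussianReal_eq_integral_smul (μ := 0) (f := fun x => |g' x|) hv
    simpa using this.symm
  set A : ℝ → ℝ := fun x => 1 / s x ^ 3 * s (g x) * ρ x + θ x * θ (g x) * (ρ x * g' x) with hA
  set B : ℝ → ℝ := fun x => x * θ x * s (g x) * ρ x with hB
  have hderiv : ∀ x, HasDerivAt (fun x => θ x * s (g x) * ρ x) (A x - (v : ℝ)⁻¹ * B x) x := by
    intro x
    have h1 := hasDerivAt_div_sqrt_one_add_sq x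
    have h2 := (hasDerivAt_sqrt_one_add_sq (g x)).comp x (hg x)
    refine ((h1.mul h2).mul (hasDerivAt_gaussianPDFReal_zero v x)).congr_deriv ?_
    simp only [hA, hB, hθ, hs, Function.comp_apply, Pi.mul_apply, hρ]
    field_simp
    ring
  have hAi : IntervalIntegrable A volume (-R) R := by
    refine IntervalIntegrable.add (Continuous.intervalIntegrable ?_ _ _)
      (Integrable.intervalIntegrable ?_)
    · exact ((continuous_const.div (hsc.pow 3) fun x => pow_ne_zero _ (hs0 x)).mul
        (hsc.comp hgc)).mul hρc
    · refine hi3.bdd_mul (c := 1) (hθc.mul (hθc.comp hgc)).aestronglyMeasurable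
        (ae_of_all _ fun x => ?_)
      rw [Real.norm_eq_abs, abs_mul]
      exact mul_le_one₀ (abs_div_sqrt_one_add_sq_le x) (abs_nonneg _)
        (abs_div_sqrt_one_add_sq_le (g x))
  have hBc : Continuous B := ((continuous_id.mul hθc).mul (hsc.comp hgc)).mul hρc
  have hBi : IntervalIntegrable B volume (-R) R := hBc.intervalIntegrable _ _
  have hFTC := intervalIntegral.integral_eq_sub_of_hasDerivAt (fun x _ => hderiv x)
    (hAi.sub (hBi.const_mul (v : ℝ)⁻¹))
  have hbdry : 0 ≤ θ R * s (g R) * ρ R - θ (-R) * s (g (-R)) * ρ (-R) := by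
    have h1 : 0 ≤ θ R := div_nonneg hR (hs1 R)
    have h2 : θ (-R) ≤ 0 := div_nonpos_of_nonpos_of_nonneg (by linarith) (hs1 (-R))
    have h3 : 0 ≤ θ R * s (g R) * ρ R := mul_nonneg (mul_nonneg h1 (hs1 _)) (hρ0 _)
    have h4 : 0 ≤ -θ (-R) * s (g (-R)) * ρ (-R) :=
      mul_nonneg (mul_nonneg (by linarith) (hs1 _)) (hρ0 _)
    linarith
  rw [intervalIntegral.integral_sub hAi (hBi.const_mul _),
    intervalIntegral.integral_const_mul] at hFTC
  have hBA : ∫ x in (-R)..R, B x ≤ v * ∫ x in (-R)..R, A x := by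
    have : (v : ℝ)⁻¹ * ∫ x in (-R)..R, B x ≤ ∫ x in (-R)..R, A x := by linarith
    rwa [inv_mul_le_iff₀ hvpos] at this
  have hRR : -R ≤ R := by linarith
  have hmono : ∀ f : ℝ → ℝ, (∀ x, 0 ≤ f x) → Integrable f →
      ∫ x in (-R)..R, f x ≤ ∫ x, f x := by
    intro f hf hfi
    rw [intervalIntegral.integral_of_le hRR]
    exact setIntegral_le_integral hfi (ae_of_all _ hf)
  have hi1' : ∀ x, 0 ≤ ρ x * (1 + |g x|) := fun x => mul_nonneg (hρ0 x) (by positivity)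
  have hi2' : ∀ x, 0 ≤ ρ x * |g' x| := fun x => mul_nonneg (hρ0 x) (abs_nonneg _)
  have hAle : ∫ x in (-R)..R, A x ≤ (∫ x, ρ x * (1 + |g x|)) + ∫ x, ρ x * |g' x| := by
    rw [← integral_add hi1 hi2]
    refine le_trans (intervalIntegral.integral_mono_on hRR hAi
      (hi1.add hi2).intervalIntegrable fun x _ => ?_)
      (hmono _ (fun x => add_nonneg (hi1' x) (hi2' x)) (hi1.add hi2))
    refine add_le_add ?_ ?_
    · rw [mul_comm]
      refine mul_le_mul_of_nonneg_left ?_ (hρ0 x)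
      refine le_trans ?_ (sqrt_one_add_sq_le (g x))
      refine mul_le_of_le_one_left (hs1 _) ?_
      rw [div_le_one (pow_pos (sqrt_one_add_sq_pos x) 3)]
      exact one_le_pow₀ (one_le_sqrt_one_add_sq x)
    · refine (le_abs_self _).trans ?_
      rw [abs_mul, abs_mul, abs_mul, abs_of_nonneg (hρ0 x)]
      refine mul_le_of_le_one_left (hi2' x) ?_
      exact mul_le_one₀ (abs_div_sqrt_one_add_sq_le x) (abs_nonneg _)
        (abs_div_sqrt_one_add_sq_le (g x))
  have hfin : ∫ x in (-R)..R, ‖ρ x * (x * g x)‖ ≤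
      (∫ x in (-R)..R, B x) + ∫ x in (-R)..R, ρ x * (1 + |g x|) := by
    rw [← intervalIntegral.integral_add hBi hi1.intervalIntegrable]
    refine intervalIntegral.integral_mono_on hRR
      ((hρc.mul (continuous_id.mul hgc)).norm.intervalIntegrable _ _)
      (hBi.add hi1.intervalIntegrable) fun x _ => ?_
    have k1 : |x| ≤ x * θ x + 1 := abs_le_mul_div_sqrt_add_one x
    have k2 : |g x| ≤ s (g x) := abs_le_sqrt_one_add_sq (g x)
    have k3 : s (g x) ≤ 1 + |g x| := sqrt_one_add_sq_le (g x)
    have k4 : |x| * |g x| ≤ (x * θ x + 1) * s (g x) :=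
      mul_le_mul k1 k2 (abs_nonneg _) ((abs_nonneg x).trans k1)
    rw [Real.norm_eq_abs, abs_mul, abs_mul, abs_of_nonneg (hρ0 x)]
    calc ρ x * (|x| * |g x|) ≤ ρ x * ((x * θ x + 1) * s (g x)) :=
          mul_le_mul_of_nonneg_left k4 (hρ0 x)
      _ = B x + ρ x * s (g x) := by simp only [hB]; ring
      _ ≤ B x + ρ x * (1 + |g x|) := by gcongr; exact hρ0 x
  have h5 := hmono _ hi1' hi1
  rw [← e1, ← e2]
  nlinarith [mul_le_mul_of_nonneg_left hAle hvpos.le]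

theorem integrable_mul_pdf_of_hasDerivAt (hv : v ≠ 0) (hg : ∀ x, HasDerivAt g (g' x) x)
    (hgi : Integrable g (gaussianReal 0 v)) (hg'i : Integrable g' (gaussianReal 0 v)) :
    Integrable (fun x => gaussianPDFReal 0 v x * (x * g x)) := by
  have hgc : Continuous g := continuous_iff_continuousAt.2 fun x => (hg x).continuousAt
  have hρc : Continuous (gaussianPDFReal 0 v) :=
    continuous_iff_continuousAt.2 fun x => (hasDerivAt_gaussianPDFReal_zero v x).continuousAt
  refine integrable_of_intervalIntegral_norm_bounded (l := atTop)
    (a := fun R : ℝ => -R) (b := fun R : ℝ => R) _ (fun R => ?_) tendsto_neg_atTop_atBot tendsto_id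
    ((eventually_ge_atTop 0).mono fun R hR =>
      intervalIntegral_abs_mul_gaussian_le hv hg hgi hg'i hR)
  exact ((hρc.mul (continuous_id.mul hgc)).integrableOn_Icc).mono_set Set.Ioc_subset_Icc_self

theorem integrable_id_mul_gaussianReal (hv : v ≠ 0) (hg : ∀ x, HasDerivAt g (g' x) x)
    (hgi : Integrable g (gaussianReal 0 v)) (hg'i : Integrable g' (gaussianReal 0 v)) :
    Integrable (fun x => x * g x) (gaussianReal 0 v) :=
  (integrable_gaussianReal_iff hv _).2 (integrable_mul_pdf_of_hasDerivAt hv hg hgi hg'i)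

theorem integral_abs_id_mul_gaussianReal_le (hv : v ≠ 0) (hg : ∀ x, HasDerivAt g (g' x) x)
    (hgi : Integrable g (gaussianReal 0 v)) (hg'i : Integrable g' (gaussianReal 0 v)) :
    ∫ x, ‖x * g x‖ ∂gaussianReal 0 v ≤
      (v + 1) * (1 + ∫ x, |g x| ∂gaussianReal 0 v) + v * ∫ x, |g' x| ∂gaussianReal 0 v := by
  have h := intervalIntegral_tendsto_integral (l := atTop)
    (integrable_mul_pdf_of_hasDerivAt hv hg hgi hg'i).norm
    (a := fun R : ℝ => -R) (b := fun R : ℝ => R) tendsto_neg_atTop_atBot tendsto_id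
  have e : ∫ x, ‖x * g x‖ ∂gaussianReal 0 v = ∫ x, ‖gaussianPDFReal 0 v x * (x * g x)‖ := by
    rw [integral_gaussianReal_eq_integral_smul hv]
    refine integral_congr_ae (ae_of_all _ fun x => ?_)
    simp only [smul_eq_mul]
    rw [norm_mul (gaussianPDFReal 0 v x), Real.norm_of_nonneg (gaussianPDFReal_nonneg 0 v x)]
  rw [e]
  exact le_of_tendsto h ((eventually_ge_atTop 0).mono fun R hR =>
    intervalIntegral_abs_mul_gaussian_le hv hg hgi hg'i hR)

/-- Stein's identity. -/
theorem integral_id_mul_gaussianReal (hv : v ≠ 0) (hg : ∀ x, HasDerivAt g (g' x) x)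
    (hgi : Integrable g (gaussianReal 0 v)) (hg'i : Integrable g' (gaussianReal 0 v)) :
    ∫ x, x * g x ∂gaussianReal 0 v = v * ∫ x, g' x ∂gaussianReal 0 v := by
  have hvpos : (0 : ℝ) < v := by positivity
  have h0 := (integrable_gaussianReal_iff hv _).1 hgi
  have h1 := (integrable_gaussianReal_iff hv _).1 hg'i
  have h2 := integrable_mul_pdf_of_hasDerivAt hv hg hgi hg'i
  have := integral_mul_deriv_eq_deriv_mul_of_integrable (u := g) (u' := g')
    (v := gaussianPDFReal 0 v) (v' := fun x => -(x / v) * gaussianPDFReal 0 v x)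
    (fun x _ => hg x) (fun x _ => hasDerivAt_gaussianPDFReal_zero v x)
    ((h2.const_mul (-(v : ℝ)⁻¹)).congr (ae_of_all _ fun x => by
      simp only [Pi.mul_apply]; ring))
    (h1.congr (ae_of_all _ fun x => by simp only [Pi.mul_apply]; ring))
    (h0.congr (ae_of_all _ fun x => by simp only [Pi.mul_apply]; ring))
  rw [integral_gaussianReal_eq_integral_smul hv, integral_gaussianReal_eq_integral_smul hv]
  simp only [smul_eq_mul]
  have e1 : ∫ x, g x * (-(x / v) * gaussianPDFReal 0 v x) =
      -(v : ℝ)⁻¹ * ∫ x, gaussianPDFReal 0 v x * (x * g x) := by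
    rw [← integral_const_mul]
    exact integral_congr_ae (ae_of_all _ fun x => by simp only []; ring)
  have e2 : ∫ x, g' x * gaussianPDFReal 0 v x = ∫ x, gaussianPDFReal 0 v x * g' x :=
    integral_congr_ae (ae_of_all _ fun x => mul_comm _ _)
  rw [e1, e2] at this
  field_simp at this
  simp_rw [mul_assoc] at this
  linarith

end Stein

/-! ### Increments of a path sampled at finitely many times -/

section Increments

variable {E : Type*} [AddCommGroup E]

/-- The increments `y₁ - 0, y₂ - y₁, …, y_k - y_{k-1}` of a finite sequence started at `0`. -/
def increments {k : ℕ} (y : Fin k → E) (i : Fin k) : E :=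
  (Fin.cons 0 y : Fin (k + 1) → E) i.succ - (Fin.cons 0 y : Fin (k + 1) → E) i.castSucc

theorem cons_zero_castSucc_snoc {k : ℕ} (y : Fin (k + 1) → E) (i : Fin (k + 1)) :
    (Fin.cons 0 y : Fin (k + 2) → E) i.castSucc =
      (Fin.cons 0 (fun j : Fin k => y j.castSucc) : Fin (k + 1) → E) i := by
  refine Fin.cases ?_ (fun j => ?_) i
  · simp
  · rw [Fin.cons_succ, ← Fin.succ_castSucc, Fin.cons_succ]

theorem increments_castSucc {k : ℕ} (y : Fin (k + 1) → E) (i : Fin k) :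
    increments y i.castSucc = increments (fun j : Fin k => y j.castSucc) i := by
  simp only [increments, Fin.cons_succ, cons_zero_castSucc_snoc]

theorem increments_last {k : ℕ} (y : Fin (k + 1) → E) :
    increments y (Fin.last k) = y (Fin.last k) -
      (Fin.cons 0 (fun j : Fin k => y j.castSucc) : Fin (k + 1) → E) (Fin.last k) := by
  simp only [increments, Fin.cons_succ, cons_zero_castSucc_snoc]

/-- Abel summation: a linear combination of the values of a sequence started at `0` is a linear
combination of its increments. -/
theorem exists_sum_eq_sum_increments {W : Type*} [AddCommGroup W] {k : ℕ} (b : Fin k → W) :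
    ∃ c : Fin k → W, ∀ {E : Type} {R : Type} [AddCommGroup E] [AddCommGroup R]
      (β : W →+ E →+ R) (y : Fin k → E),
      ∑ j, β (b j) (y j) = ∑ j, β (c j) (increments y j) := by
  induction k with
  | zero => exact ⟨b, fun β y => by simp⟩
  | succ k ih =>
    rcases k with _ | k
    · exact ⟨b, fun β y => by simp [increments]⟩
    · -- the weight of the last point is moved to the point before it
      obtain ⟨c, hc⟩ := ih (fun j => b j.castSucc + if j = Fin.last k then b (Fin.last _) else 0)
      refine ⟨Fin.snoc c (b (Fin.last _)), fun {E R} _ _ β y => ?_⟩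
      have h := hc β (fun j => y j.castSucc)
      rw [Fin.sum_univ_castSucc, Fin.sum_univ_castSucc (f := fun j => β _ (increments y j))]
      simp only [Fin.snoc_castSucc, Fin.snoc_last, increments_castSucc, ← h, increments_last]
      simp only [map_add, AddMonoidHom.add_apply, Finset.sum_add_distrib, map_sub]
      have h2 : ∑ x : Fin (k + 1), (β (if x = Fin.last k then b (Fin.last (k + 1)) else 0))
          (y x.castSucc) = β (b (Fin.last (k + 1))) (y (Fin.last k).castSucc) := by
        rw [Finset.sum_eq_single (Fin.last k)]
        · simp
        · intro x _ hx
          simp [hx]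
        · simp
      have h3 : (Fin.cons 0 (fun j : Fin (k + 1) => y j.castSucc) : Fin (k + 2) → E)
          (Fin.last (k + 1)) = y (Fin.last k).castSucc := by
        rw [← Fin.succ_last, Fin.cons_succ]
      rw [h2, h3]
      abel

end Increments

section Volume

variable {E : Type*} [NormedAddCommGroup E] [InnerProductSpace ℝ E] [FiniteDimensional ℝ E]
  [MeasurableSpace E] [BorelSpace E]

theorem measurable_increments {k : ℕ} :
    Measurable (increments : (Fin k → E) → (Fin k → E)) := by
  refine measurable_pi_lambda _ fun i => ?_
  have h : ∀ j : Fin (k + 1),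
      Measurable fun y : Fin k → E => (Fin.cons 0 y : Fin (k + 1) → E) j := by
    intro j
    refine Fin.cases ?_ (fun j => ?_) j
    · simp
    · simpa using measurable_pi_apply j
  exact (h _).sub (h _)

/-- Passing to increments preserves Lebesgue measure. -/
theorem measurePreserving_increments (k : ℕ) :
    MeasurePreserving (increments : (Fin k → E) → (Fin k → E)) volume volume := by
  induction k with
  | zero =>
    have : (increments : (Fin 0 → E) → (Fin 0 → E)) = id := by
      funext y; exact Subsingleton.elim _ _
    rw [this]
    exact MeasurePreserving.id _
  | succ k ih =>
    let e := MeasurableEquiv.piFinSuccAbove (fun _ : Fin (k + 1) => E) (Fin.last k)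
    have he : MeasurePreserving e volume volume :=
      volume_preserving_piFinSuccAbove (fun _ : Fin (k + 1) => E) (Fin.last k)
    have hcons : Measurable fun a : Fin k → E =>
        (Fin.cons 0 a : Fin (k + 1) → E) (Fin.last k) := by
      refine Fin.cases ?_ (fun j => ?_) (Fin.last k)
      · simp
      · simpa using measurable_pi_apply j
    have hskew : MeasurePreserving
        (fun p : (Fin k → E) × E =>
          (increments p.1, p.2 - (Fin.cons 0 p.1 : Fin (k + 1) → E) (Fin.last k)))
        (volume.prod volume) (volume.prod volume) := by
      refine ih.skew_product
        (g := fun a z => z - (Fin.cons 0 a : Fin (k + 1) → E) (Fin.last k)) ?_ ?_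
      · exact measurable_snd.sub (hcons.comp measurable_fst)
      · exact Filter.Eventually.of_forall fun a =>
          (measurePreserving_sub_right volume _).map_eq
    have hswap := MeasureTheory.Measure.measurePreserving_swap (μ := (volume : Measure E))
      (ν := (volume : Measure (Fin k → E)))
    have hswap' := MeasureTheory.Measure.measurePreserving_swap
      (μ := (volume : Measure (Fin k → E))) (ν := (volume : Measure E))
    have key := (he.symm e).comp (hswap'.comp (hskew.comp (hswap.comp he)))
    suffices hfun : (increments : (Fin (k + 1) → E) → (Fin (k + 1) → E)) = e.symm ∘ Prod.swap ∘
        (fun p : (Fin k → E) × E =>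
          (increments p.1, p.2 - (Fin.cons 0 p.1 : Fin (k + 1) → E) (Fin.last k))) ∘
        Prod.swap ∘ e by
      rw [hfun]; exact key
    funext y
    simp only [Function.comp_apply]
    rw [MeasurableEquiv.eq_symm_apply]
    have h1 : ∀ z : Fin (k + 1) → E, e z = (z (Fin.last k), fun j : Fin k => z j.castSucc) := by
      intro z
      simp [e, MeasurableEquiv.piFinSuccAbove, Fin.insertNthEquiv, Fin.init_def]
    rw [h1, h1]
    refine Prod.ext ?_ ?_
    · simp [increments_last]
    · funext j
      simp [increments_castSucc]

end Volume

section HeatKernel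

open Complex

theorem heatKernel_eq_sub (n : ℕ) (t : ℝ) (x y : EuclideanSpace ℝ (Fin n)) :
    heatKernel n t x y = heatKernel n t 0 (y - x) := by
  rw [heatKernel, heatKernel, zero_sub, norm_neg, norm_sub_rev]

theorem heatKernel_nonneg (n : ℕ) {t : ℝ} (ht : 0 < t) (x y : EuclideanSpace ℝ (Fin n)) :
    0 ≤ heatKernel n t x y := by
  unfold heatKernel
  positivity

theorem continuous_heatKernel (n : ℕ) (t : ℝ) : Continuous (heatKernel n t 0) := by
  unfold heatKernel
  fun_prop

theorem integral_heatKernel_mul_cexp (n : ℕ) {t : ℝ} (ht : 0 < t)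
    (c : EuclideanSpace ℝ (Fin n)) :
    ∫ z, (heatKernel n t 0 z : ℂ) * cexp (⟪c, z⟫ * I) = cexp (-(t * ‖c‖ ^ 2 : ℝ)) := by
  have hb : 0 < ((1 / (4 * t) : ℝ) : ℂ).re := by
    rw [ofReal_re]; positivity
  have h := GaussianFourier.integral_cexp_neg_mul_sq_norm_add hb I c
  have hpos : (0 : ℝ) < 4 * Real.pi * t := by positivity
  have e : ∀ z : EuclideanSpace ℝ (Fin n), (heatKernel n t 0 z : ℂ) * cexp (⟪c, z⟫ * I) =
      (((4 * Real.pi * t) ^ (-(n : ℝ) / 2) : ℝ) : ℂ) *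
        cexp (-((1 / (4 * t) : ℝ) : ℂ) * ‖z‖ ^ 2 + I * ⟪c, z⟫) := by
    intro z
    rw [heatKernel, ofReal_mul, mul_assoc, ofReal_exp, ← Complex.exp_add]
    congr 2
    rw [zero_sub, norm_neg]
    push_cast
    ring
  simp_rw [e]
  rw [integral_const_mul, h, ← mul_assoc]
  have e2 : (Real.pi : ℂ) / ((1 / (4 * t) : ℝ) : ℂ) = ((4 * Real.pi * t : ℝ) : ℂ) := by
    push_cast
    field_simp
  have e3 : ((Module.finrank ℝ (EuclideanSpace ℝ (Fin n)) : ℂ) / 2) = (((n : ℝ) / 2 : ℝ) : ℂ) := by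
    simp
  rw [e2, e3, ← ofReal_cpow hpos.le, ← ofReal_mul, ← Real.rpow_add hpos]
  have e4 : -(n : ℝ) / 2 + n / 2 = 0 := by ring
  rw [e4, Real.rpow_zero, ofReal_one, one_mul]
  congr 1
  rw [I_sq]
  have : (t : ℂ) ≠ 0 := by exact_mod_cast ht.ne'
  push_cast
  field_simp

theorem increments_pos {k : ℕ} {t : Fin k → ℝ} (ht : ∀ i, 0 < t i) (hmono : StrictMono t)
    (i : Fin k) : 0 < increments t i := by
  unfold increments
  rw [sub_pos, Fin.cons_succ]
  rcases k with _ | k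
  · exact i.elim0
  · refine Fin.cases ?_ (fun j => ?_) i
    · simpa using ht 0
    · rw [← Fin.succ_castSucc, Fin.cons_succ]
      exact hmono (Fin.castSucc_lt_succ)

theorem heatKernelChain_eq_prod_increments (n : ℕ) {k : ℕ} (t : Fin k → ℝ≥0)
    (y : Fin k → EuclideanSpace ℝ (Fin n)) :
    heatKernelChain n t y =
      ∏ i, heatKernel n (increments (fun j => (t j : ℝ)) i) 0 (increments y i) := by
  unfold heatKernelChain
  simp only
  refine Finset.prod_congr rfl fun i _ => ?_
  rw [heatKernel_eq_sub]
  rfl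

/-- Under Wiener measure the increments of the path over disjoint intervals are independent
centred Gaussians with covariance `2 Δt`. -/
theorem IsWienerMeasure.integral_cexp_increments {n : ℕ} {P : Measure (PathSpace n)}
    (hP : IsWienerMeasure P) {k : ℕ} (t : Fin k → ℝ≥0) (ht : ∀ i, 0 < t i) (hmono : StrictMono t)
    (c : Fin k → EuclideanSpace ℝ (Fin n)) :
    ∫ γ : PathSpace n, cexp ((∑ j, ⟪c j, increments (fun i => γ.1 (t i)) j⟫ : ℝ) * I) ∂P =
      cexp (-(∑ j, increments (fun j => (t j : ℝ)) j * ‖c j‖ ^ 2 : ℝ)) := by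
  have hpos : ∀ i, 0 < increments (fun j => (t j : ℝ)) i :=
    increments_pos (fun i => by exact_mod_cast ht i) (fun i j h => by exact_mod_cast hmono h)
  have hmeas : Measurable fun γ : PathSpace n => fun i : Fin k => γ.1 (t i) := by
    refine measurable_pi_lambda _ fun i => Continuous.measurable ?_
    exact (continuous_eval_const (t i)).comp continuous_subtype_val
  have hF : Measurable fun y : Fin k → EuclideanSpace ℝ (Fin n) =>
      cexp ((∑ j, ⟪c j, increments y j⟫ : ℝ) * I) := by
    have : ∀ j, Measurable fun y : Fin k → EuclideanSpace ℝ (Fin n) => increments y j :=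
      fun j => (measurable_pi_apply j).comp measurable_increments
    fun_prop
  have h1 := integral_map (μ := P) hmeas.aemeasurable
    (hF.aestronglyMeasurable (μ := P.map fun γ : PathSpace n => fun i : Fin k => γ.1 (t i)))
  rw [← h1, hP k t ht hmono]
  have hchain : ∀ y : Fin k → EuclideanSpace ℝ (Fin n), 0 ≤ heatKernelChain n t y := by
    intro y
    rw [heatKernelChain_eq_prod_increments]
    exact Finset.prod_nonneg fun i _ => heatKernel_nonneg n (hpos i) _ _
  have hchainm : Measurable fun y : Fin k → EuclideanSpace ℝ (Fin n) => heatKernelChain n t y := by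
    simp_rw [heatKernelChain_eq_prod_increments]
    refine Finset.measurable_prod _ fun i _ => ?_
    exact (continuous_heatKernel n _).measurable.comp
      ((measurable_pi_apply i).comp measurable_increments)
  rw [integral_withDensity_eq_integral_toReal_smul hchainm.ennreal_ofReal
    (ae_of_all _ fun y => ENNReal.ofReal_lt_top)]
  have e : ∀ y : Fin k → EuclideanSpace ℝ (Fin n),
      (ENNReal.ofReal (heatKernelChain n t y)).toReal •
        cexp ((∑ j, ⟪c j, increments y j⟫ : ℝ) * I) =
      (fun z : Fin k → EuclideanSpace ℝ (Fin n) => ∏ j,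
        ((heatKernel n (increments (fun j => (t j : ℝ)) j) 0 (z j) : ℝ) : ℂ) *
          cexp (⟪c j, z j⟫ * I)) (increments y) := by
    intro y
    beta_reduce
    rw [ENNReal.toReal_ofReal (hchain y), Finset.prod_mul_distrib, ← Complex.exp_sum,
      heatKernelChain_eq_prod_increments, real_smul, ofReal_prod, ofReal_sum, Finset.sum_mul]
  simp_rw [e]
  have hmp := measurePreserving_increments (E := EuclideanSpace ℝ (Fin n)) k
  have hG : Measurable (fun z : Fin k → EuclideanSpace ℝ (Fin n) => ∏ j,
        ((heatKernel n (increments (fun j => (t j : ℝ)) j) 0 (z j) : ℝ) : ℂ) *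
          cexp (⟪c j, z j⟫ * I)) := by
    refine Continuous.measurable ?_
    refine continuous_finsetProd _ fun j _ => ?_
    have := (continuous_heatKernel n (increments (fun j => (t j : ℝ)) j)).comp
      (continuous_apply (A := fun _ : Fin k => EuclideanSpace ℝ (Fin n)) j)
    have h' : Continuous fun z : Fin k → EuclideanSpace ℝ (Fin n) => ⟪c j, z j⟫ := by fun_prop
    exact (continuous_ofReal.comp this).mul (by fun_prop)
  have h2 := integral_map (μ := volume) hmp.measurable.aemeasurable
    (hG.aestronglyMeasurable (μ := volume.map increments))
  rw [← h2, hmp.map_eq, integral_fintype_prod_volume_eq_prod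
    (f := fun j (z : EuclideanSpace ℝ (Fin n)) =>
      ((heatKernel n (increments (fun j => (t j : ℝ)) j) 0 z : ℝ) : ℂ) * cexp (⟪c j, z⟫ * I))]
  simp_rw [integral_heatKernel_mul_cexp n (hpos _), ← Complex.exp_sum, ofReal_sum,
    Finset.sum_neg_distrib]

end HeatKernel

/-! ### Step functions in `L²(0, ∞)` -/

section HalfLine

/-- The Hilbert space `L²(0, ∞)`, in which derivatives of functions of class `H¹₀` live. -/
abbrev HalfLineL2 : Type := Lp ℝ 2 (volume.restrict (Set.Ioi (0 : ℝ)))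

theorem volume_restrict_Ioc_ne_top (t : ℝ≥0) :
    (volume.restrict (Set.Ioi (0 : ℝ))) (Set.Ioc (0 : ℝ) t) ≠ ⊤ :=
  ((Measure.restrict_apply_le _ _).trans_lt measure_Ioc_lt_top).ne

/-- The indicator function of `(0, t]`, as an element of `L²(0, ∞)`. -/
noncomputable def stepL2 (t : ℝ≥0) : HalfLineL2 :=
  indicatorConstLp 2 (measurableSet_Ioc (a := (0 : ℝ)) (b := t)) (volume_restrict_Ioc_ne_top t) 1

theorem inner_stepL2_stepL2 (s t : ℝ≥0) : ⟪stepL2 s, stepL2 t⟫ = min (s : ℝ) t := by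
  rw [stepL2, stepL2, L2.real_inner_indicatorConstLp_one_indicatorConstLp_one
    measurableSet_Ioc measurableSet_Ioc (volume_restrict_Ioc_ne_top s)
    (volume_restrict_Ioc_ne_top t), measureReal_restrict_apply (by measurability),
    Set.Ioc_inter_Ioc, Set.inter_eq_left.2 (fun x hx => by
      simp only [Set.mem_Ioc, sup_idem] at hx; exact hx.1)]
  simp

theorem inner_stepL2 (t : ℝ≥0) (f : HalfLineL2) :
    ⟪stepL2 t, f⟫ = ∫ x in Set.Ioc (0 : ℝ) t, f x := by
  rw [stepL2, L2.inner_indicatorConstLp_one measurableSet_Ioc,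
    Measure.restrict_restrict measurableSet_Ioc,
    Set.inter_eq_left.2 Set.Ioc_subset_Ioi_self]

theorem stepL2_zero : stepL2 0 = 0 := by
  rw [← inner_self_eq_zero (𝕜 := ℝ), inner_stepL2_stepL2]
  simp

/-- A function orthogonal to all steps has vanishing primitive, hence vanishes by Lebesgue's
differentiation theorem. -/
theorem dense_span_stepL2 :
    (Submodule.span ℝ (Set.range stepL2)).topologicalClosure = ⊤ := by
  rw [Submodule.topologicalClosure_eq_top_iff, Submodule.eq_bot_iff]
  intro f hf
  have h0 : ∀ t : ℝ≥0, ∫ x in Set.Ioc (0 : ℝ) t, f x = 0 := fun t => by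
    rw [← inner_stepL2]
    exact hf _ (Submodule.subset_span ⟨t, rfl⟩)
  have hloc : LocallyIntegrable (Set.indicator (Set.Ioi (0 : ℝ)) f) volume :=
    ((memLp_indicator_iff_restrict measurableSet_Ioi).2 (Lp.memLp f)).locallyIntegrable
      (by norm_num)
  rw [Lp.eq_zero_iff_ae_eq_zero]
  refine (ae_restrict_iff' measurableSet_Ioi).2 ?_
  filter_upwards [LocallyIntegrable.ae_hasDerivAt_integral hloc] with x hx hx0
  have hx0' : 0 < x := hx0
  have h1 : (fun y => ∫ t in (0 : ℝ)..y, Set.indicator (Set.Ioi (0 : ℝ)) f t) =ᶠ[nhds x]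
      fun _ => 0 := by
    filter_upwards [lt_mem_nhds hx0'] with y hy
    rw [intervalIntegral.integral_of_le hy.le]
    refine (setIntegral_congr_fun measurableSet_Ioc fun z hz => ?_).trans (h0 ⟨y, hy.le⟩)
    exact Set.indicator_of_mem hz.1 _
  have h2 := (hx 0).unique ((hasDerivAt_const x (0 : ℝ)).congr_of_eventuallyEq h1)
  rwa [Set.indicator_of_mem hx0] at h2

/-- The derivative of `φ`, as an element of `L²(0, ∞)`. -/
noncomputable def HOneZero.derivL2 (φ : HOneZero) : HalfLineL2 := φ.deriv_memLp.toLp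

theorem HOneZero.inner_stepL2_derivL2 (φ : HOneZero) (t : ℝ≥0) :
    ⟪stepL2 t, φ.derivL2⟫ = φ.toFun t := by
  rw [inner_stepL2]
  have h1 : ∫ x in Set.Ioc (0 : ℝ) t, φ.derivL2 x = ∫ x in Set.Ioc (0 : ℝ) t, deriv φ.toFun x := by
    refine setIntegral_congr_ae measurableSet_Ioc ?_
    filter_upwards [(ae_restrict_iff' measurableSet_Ioi).1 (φ.deriv_memLp.coeFn_toLp)] with x hx hx'
    exact hx hx'.1
  rw [h1, ← intervalIntegral.integral_of_le t.coe_nonneg]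
  rcases eq_or_lt_of_le t.coe_nonneg with h | h
  · rw [show (t : ℝ) = 0 from h.symm, intervalIntegral.integral_same, φ.map_zero]
  · rw [(φ.absCont t h).integral_deriv_eq_sub, φ.map_zero, sub_zero]

theorem HOneZero.norm_derivL2_sq (φ : HOneZero) : ‖φ.derivL2‖ ^ 2 = φ.normSq := by
  rw [← real_inner_self_eq_norm_sq, L2.inner_def, HOneZero.normSq]
  refine integral_congr_ae ?_
  filter_upwards [φ.deriv_memLp.coeFn_toLp] with x hx
  rw [HOneZero.derivL2, hx]
  simp [sq]

end HalfLine

/-! ### The Gaussian functionals of Wiener measure -/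

section CharacteristicFunction

open Complex

/-- The linear functional `γ ↦ ∑ t, ⟪b t, γ t⟫` on paths given by finitely many vectors `b t`. -/
noncomputable def pathPairing (n : ℕ) :
    (ℝ≥0 →₀ EuclideanSpace ℝ (Fin n)) →ₗ[ℝ] PathSpace n →ₗ[ℝ] ℝ :=
  Finsupp.lsum ℝ fun t => LinearMap.mk₂ ℝ
    (fun (w : EuclideanSpace ℝ (Fin n)) (γ : PathSpace n) => ⟪w, γ.1 t⟫)
    (fun _ _ _ => inner_add_left _ _ _) (fun _ _ _ => real_inner_smul_left _ _ _)
    (fun _ _ _ => inner_add_right _ _ _) (fun _ _ _ => real_inner_smul_right _ _ _)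

/-- The `i`-th component of `∑ t, b t 1_{(0, t]}`. Wiener measure sends these step functions
isometrically, up to a factor `√2`, to the functionals `pathPairing n b`. -/
noncomputable def stepSum (n : ℕ) (i : Fin n) :
    (ℝ≥0 →₀ EuclideanSpace ℝ (Fin n)) →ₗ[ℝ] HalfLineL2 :=
  Finsupp.lsum ℝ fun t => (EuclideanSpace.proj (𝕜 := ℝ) i).toLinearMap.smulRight (stepL2 t)

theorem pathPairing_apply {n : ℕ} (b : ℝ≥0 →₀ EuclideanSpace ℝ (Fin n)) (γ : PathSpace n) :
    pathPairing n b γ = ∑ t ∈ b.support, ⟪b t, γ.1 t⟫ := by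
  simp [pathPairing, Finsupp.sum, LinearMap.sum_apply]

theorem stepSum_apply {n : ℕ} (i : Fin n) (b : ℝ≥0 →₀ EuclideanSpace ℝ (Fin n)) :
    stepSum n i b = ∑ t ∈ b.support, b t i • stepL2 t := by
  simp [stepSum, Finsupp.sum]

theorem pathPairing_single {n : ℕ} (t : ℝ≥0) (w : EuclideanSpace ℝ (Fin n)) (γ : PathSpace n) :
    pathPairing n (Finsupp.single t w) γ = ⟪w, γ.1 t⟫ := by
  simp [pathPairing]

theorem stepSum_single {n : ℕ} (i : Fin n) (t : ℝ≥0) (w : EuclideanSpace ℝ (Fin n)) :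
    stepSum n i (Finsupp.single t w) = w i • stepL2 t := by
  simp [stepSum]

theorem continuous_pathPairing {n : ℕ} (b : ℝ≥0 →₀ EuclideanSpace ℝ (Fin n)) :
    Continuous (pathPairing n b) := by
  have : (pathPairing n b : PathSpace n → ℝ) = fun γ => ∑ t ∈ b.support, ⟪b t, γ.1 t⟫ :=
    funext fun γ => pathPairing_apply b γ
  rw [this]
  refine continuous_finsetSum _ fun t _ => ?_
  exact continuous_const.inner ((continuous_eval_const t).comp continuous_subtype_val)

/-- On a direction `φ v` the pairing is the `L²` inner product of `φ'` with the step function. -/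
theorem pathPairing_path_single {n : ℕ} (φ : HOneZero) (i : Fin n)
    (b : ℝ≥0 →₀ EuclideanSpace ℝ (Fin n)) :
    pathPairing n b (φ.path (EuclideanSpace.single i 1)) = ⟪stepSum n i b, φ.derivL2⟫ := by
  rw [pathPairing_apply, stepSum_apply, sum_inner]
  refine Finset.sum_congr rfl fun t _ => ?_
  rw [real_inner_smul_left, φ.inner_stepL2_derivL2]
  change ⟪b t, φ.toFun t • EuclideanSpace.single i (1 : ℝ)⟫ = _
  rw [real_inner_smul_right, EuclideanSpace.inner_single_right]
  simp [mul_comm]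

theorem increments_comp_eq {A : Type*} [AddCommGroup A] {k : ℕ} (f : ℝ≥0 → A) (hf : f 0 = 0)
    (t : Fin k → ℝ≥0) (i : Fin k) :
    increments (fun j => f (t j)) i =
      f ((Fin.cons 0 t : Fin (k + 1) → ℝ≥0) i.succ) -
        f ((Fin.cons 0 t : Fin (k + 1) → ℝ≥0) i.castSucc) := by
  have h : ∀ j : Fin (k + 1), (Fin.cons 0 (fun j => f (t j)) : Fin (k + 1) → A) j =
      f ((Fin.cons 0 t : Fin (k + 1) → ℝ≥0) j) := by
    intro j
    refine Fin.cases ?_ (fun j => ?_) j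
    · simp [hf]
    · simp
  simp only [increments, h]

theorem monotone_cons_zero {k : ℕ} {t : Fin k → ℝ≥0} (ht : StrictMono t) :
    Monotone (Fin.cons 0 t : Fin (k + 1) → ℝ≥0) := by
  rcases k with _ | k
  · intro i j _
    rw [Subsingleton.elim (α := Fin 1) i j]
  · refine Fin.monotone_iff_le_succ.2 fun i => ?_
    refine Fin.cases ?_ (fun j => ?_) i
    · simp
    · rw [← Fin.succ_castSucc, Fin.cons_succ, Fin.cons_succ]
      exact (ht Fin.castSucc_lt_succ).le

theorem inner_increments_stepL2 {k : ℕ} {t : Fin k → ℝ≥0} (ht : StrictMono t) (i j : Fin k) :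
    ⟪increments (fun l => stepL2 (t l)) i, increments (fun l => stepL2 (t l)) j⟫ =
      if i = j then increments (fun l => (t l : ℝ)) i else 0 := by
  have hm := monotone_cons_zero ht
  rw [increments_comp_eq stepL2 stepL2_zero, increments_comp_eq stepL2 stepL2_zero,
    increments_comp_eq (fun s : ℝ≥0 => (s : ℝ)) rfl]
  simp only [inner_sub_left, inner_sub_right, inner_stepL2_stepL2]
  set τ : Fin (k + 1) → ℝ := fun l => ((Fin.cons 0 t : Fin (k + 1) → ℝ≥0) l : ℝ) with hτ
  have hτm : Monotone τ := fun a b h => NNReal.coe_le_coe.2 (hm h)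
  change (min (τ i.succ) (τ j.succ) - min (τ i.castSucc) (τ j.succ)) -
    (min (τ i.succ) (τ j.castSucc) - min (τ i.castSucc) (τ j.castSucc)) =
      if i = j then τ i.succ - τ i.castSucc else 0
  have hi : τ i.castSucc ≤ τ i.succ := hτm (Fin.castSucc_le_succ i)
  have hj : τ j.castSucc ≤ τ j.succ := hτm (Fin.castSucc_le_succ j)
  split_ifs with h
  · subst h
    simp [min_eq_left hi, min_eq_right hi]
  · rcases lt_or_gt_of_ne h with h | h
    · have h1 : τ i.succ ≤ τ j.castSucc := hτm (Fin.succ_le_castSucc_iff.2 h)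
      rw [min_eq_left (h1.trans hj), min_eq_left (hi.trans (h1.trans hj)), min_eq_left h1,
        min_eq_left (hi.trans h1)]
      ring
    · have h1 : τ j.succ ≤ τ i.castSucc := hτm (Fin.succ_le_castSucc_iff.2 h)
      rw [min_eq_right (h1.trans hi), min_eq_right h1, min_eq_right (hj.trans (h1.trans hi)),
        min_eq_right (hj.trans h1)]
      ring

theorem norm_sum_smul_increments_stepL2_sq {k : ℕ} {t : Fin k → ℝ≥0} (ht : StrictMono t)
    (a : Fin k → ℝ) :
    ‖∑ j, a j • increments (fun l => stepL2 (t l)) j‖ ^ 2 =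
      ∑ j, increments (fun l => (t l : ℝ)) j * a j ^ 2 := by
  rw [← real_inner_self_eq_norm_sq, sum_inner]
  refine Finset.sum_congr rfl fun i _ => ?_
  rw [inner_sum, Finset.sum_eq_single i]
  · rw [real_inner_smul_left, real_inner_smul_right, inner_increments_stepL2 ht, if_pos rfl]
    ring
  · intro j _ hj
    rw [real_inner_smul_left, real_inner_smul_right, inner_increments_stepL2 ht, if_neg hj.symm]
    ring
  · simp

/-- Wiener measure is the centred Gaussian measure for which the functionals `pathPairing n b`
have variance `2 ∑ i, ‖stepSum n i b‖²`. -/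
theorem IsWienerMeasure.integral_cexp_pathPairing {n : ℕ} {P : Measure (PathSpace n)}
    (hP : IsWienerMeasure P) (b : ℝ≥0 →₀ EuclideanSpace ℝ (Fin n)) :
    ∫ γ, cexp (pathPairing n b γ * I) ∂P = cexp (-(∑ i, ‖stepSum n i b‖ ^ 2 : ℝ)) := by
  set S := b.support.erase 0 with hS
  set t : Fin S.card → ℝ≥0 := fun j => S.orderEmbOfFin rfl j with ht
  have hmono : StrictMono t := (S.orderEmbOfFin rfl).strictMono
  have hpos : ∀ i, 0 < t i := fun i =>
    pos_iff_ne_zero.2 (Finset.ne_of_mem_erase (S.orderEmbOfFin_mem rfl i))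
  have hsum : ∀ {A : Type} [AddCommGroup A] (f : ℝ≥0 → A), f 0 = 0 →
      ∑ s ∈ b.support, f s = ∑ j, f (t j) := by
    intro A _ f hf
    rw [← Finset.sum_erase _ hf, ← hS]
    conv_lhs => rw [← S.map_orderEmbOfFin_univ rfl]
    rw [Finset.sum_map]
    rfl
  obtain ⟨c, hc⟩ := exists_sum_eq_sum_increments (fun j => b (t j))
  have h1 : ∀ γ : PathSpace n, pathPairing n b γ =
      ∑ j, ⟪c j, increments (fun i => γ.1 (t i)) j⟫ := by
    intro γ
    rw [pathPairing_apply, hsum (fun s => ⟪b s, γ.1 s⟫) (by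
      have : γ.1 0 = 0 := γ.2
      simp [this])]
    exact hc (AddMonoidHom.mk' (fun w : EuclideanSpace ℝ (Fin n) => AddMonoidHom.mk'
      (fun y : EuclideanSpace ℝ (Fin n) => ⟪w, y⟫) fun x y => inner_add_right _ _ _)
      fun x y => by ext1 z; exact inner_add_left x y z) (fun j => γ.1 (t j))
  have h2 : ∀ i, stepSum n i b = ∑ j, c j i • increments (fun l => stepL2 (t l)) j := by
    intro i
    rw [stepSum_apply, hsum (fun s => b s i • stepL2 s) (by simp [stepL2_zero])]
    exact hc (AddMonoidHom.mk' (fun w : EuclideanSpace ℝ (Fin n) => AddMonoidHom.mk'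
      (fun y : HalfLineL2 => w i • y) fun x y => smul_add _ _ _)
      fun x y => by ext1 z; exact add_smul _ _ _) (fun j => stepL2 (t j))
  simp_rw [h1]
  rw [hP.integral_cexp_increments t hpos hmono c]
  congr 3
  simp_rw [h2, norm_sum_smul_increments_stepL2_sq hmono]
  rw [Finset.sum_comm]
  refine Finset.sum_congr rfl fun j _ => ?_
  rw [← Finset.mul_sum, EuclideanSpace.real_norm_sq_eq]

theorem IsWienerMeasure.isProbabilityMeasure {n : ℕ} {P : Measure (PathSpace n)}
    (hP : IsWienerMeasure P) : IsProbabilityMeasure P := by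
  have h := hP 0 Fin.elim0 (fun i => i.elim0) (fun i => i.elim0)
  have hm : Measurable fun γ : PathSpace n => fun i : Fin 0 => γ.1 (Fin.elim0 i : ℝ≥0) :=
    measurable_pi_lambda _ fun i => i.elim0
  have h2 := congrArg (fun μ => μ Set.univ) h
  simp only [Measure.map_apply hm MeasurableSet.univ, Set.preimage_univ,
    withDensity_apply _ MeasurableSet.univ, Measure.restrict_univ] at h2
  refine ⟨h2.trans ?_⟩
  simp [heatKernelChain, Measure.volume_pi_eq_dirac (0 : Fin 0 → EuclideanSpace ℝ (Fin n))]

end CharacteristicFunction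

/-! ### Measures on path space and their characteristic functions -/

section PathSpaceTopology

open Complex Topology

instance secondCountableTopology_pathSpace (n : ℕ) : SecondCountableTopology (PathSpace n) :=
  inferInstanceAs (SecondCountableTopology
    (basedPaths n : Set C(ℝ≥0, EuclideanSpace ℝ (Fin n))))

instance isCountablyGenerated_uniformity_pathSpace (n : ℕ) :
    (uniformity (PathSpace n)).IsCountablyGenerated := by
  rw [uniformity_subtype]
  exact Filter.comap.isCountablyGenerated _ _

instance completeSpace_pathSpace (n : ℕ) : CompleteSpace (PathSpace n) := by
  have h : IsClosed (basedPaths n : Set C(ℝ≥0, EuclideanSpace ℝ (Fin n))) :=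
    isClosed_eq (continuous_eval_const 0) continuous_const
  exact h.completeSpace_coe

theorem pathPairing_separates {n : ℕ} {γ : PathSpace n} (h : ∀ b, pathPairing n b γ = 0) :
    γ = 0 := by
  refine Subtype.ext (ContinuousMap.ext fun t => ?_)
  have := h (Finsupp.single t (γ.1 t))
  rw [pathPairing_single, inner_self_eq_zero] at this
  simpa using this

/-- Finite measures on `ℝ × P₀ℝⁿ` are determined by the characteristic functions of their
finite-dimensional marginals. -/
theorem measure_ext_of_integral_cexp_pathPairing {n : ℕ} {μ ν : Measure (ℝ × PathSpace n)}
    [IsFiniteMeasure μ] [IsFiniteMeasure ν]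
    (h : ∀ (u : ℝ) (b : ℝ≥0 →₀ EuclideanSpace ℝ (Fin n)),
      ∫ z, cexp ((u * z.1 + pathPairing n b z.2 : ℝ) * I) ∂μ =
        ∫ z, cexp ((u * z.1 + pathPairing n b z.2 : ℝ) * I) ∂ν) : μ = ν := by
  have hpair : ∀ w : ℝ × (ℝ≥0 →₀ EuclideanSpace ℝ (Fin n)), Continuous
      fun z : ℝ × PathSpace n => w.1 * z.1 + pathPairing n w.2 z.2 := fun w =>
    (continuous_const.mul continuous_fst).add ((continuous_pathPairing w.2).comp continuous_snd)
  let _ : PseudoMetricSpace (ℝ × PathSpace n) := UniformSpace.pseudoMetricSpace _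
  -- the test functions carry the discrete topology, so that joint continuity is continuity in the
  -- path
  let _ : TopologicalSpace (ℝ × (ℝ≥0 →₀ EuclideanSpace ℝ (Fin n))) := ⊥
  have : DiscreteTopology (ℝ × (ℝ≥0 →₀ EuclideanSpace ℝ (Fin n))) := ⟨rfl⟩
  let L : (ℝ × PathSpace n) →ₗ[ℝ] (ℝ × (ℝ≥0 →₀ EuclideanSpace ℝ (Fin n))) →ₗ[ℝ] ℝ :=
    LinearMap.mk₂ ℝ (fun z w => w.1 * z.1 + pathPairing n w.2 z.2)
      (fun z z' w => by simp only [Prod.fst_add, Prod.snd_add, map_add]; ring)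
      (fun r z w => by simp only [Prod.smul_fst, Prod.smul_snd, map_smul, smul_eq_mul]; ring)
      (fun z w w' => by
        simp only [Prod.fst_add, Prod.snd_add, map_add, LinearMap.add_apply]; ring)
      (fun r z w => by
        simp only [Prod.smul_fst, Prod.smul_snd, map_smul, LinearMap.smul_apply, smul_eq_mul]
        ring)
  have hLcont : Continuous fun p : (ℝ × PathSpace n) × (ℝ × (ℝ≥0 →₀ EuclideanSpace ℝ (Fin n))) =>
      L p.1 p.2 := by
    rw [continuous_prod_of_discrete_right]
    exact hpair
  refine ext_of_integral_char_eq (L := L) Real.continuous_probChar Real.probChar_ne_one ?_ hLcont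
    fun w => ?_
  · intro z hz hLz
    apply hz
    have h1 : z.1 = 0 := by
      have := LinearMap.congr_fun hLz (1, 0)
      simpa [L] using this
    have h2 : z.2 = 0 := pathPairing_separates fun b => by
      have := LinearMap.congr_fun hLz (0, b)
      simpa [L] using this
    exact Prod.ext h1 h2
  · exact h w.1 w.2

end PathSpaceTopology

/-! ### The Paley–Wiener integral -/

section PaleyWiener

open Complex Topology Filter ProbabilityTheory

theorem HOneZero.exists_linearCombination_stepL2_near (φ : HOneZero) {ε : ℝ} (hε : 0 < ε) :
    ∃ a : ℝ≥0 →₀ ℝ, ‖Finsupp.linearCombination ℝ stepL2 a - φ.derivL2‖ < ε := by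
  have h : φ.derivL2 ∈ (Submodule.span ℝ (Set.range stepL2)).topologicalClosure := by
    rw [dense_span_stepL2]; trivial
  obtain ⟨g, hg, hd⟩ := Metric.mem_closure_iff.1 h ε hε
  obtain ⟨a, rfl⟩ := Finsupp.mem_span_range_iff_exists_finsupp.1 hg
  refine ⟨a, ?_⟩
  rw [dist_comm, dist_eq_norm] at hd
  exact hd

/-- The coefficients of step functions approximating `φ'` in `L²(0, ∞)` at a geometric rate. -/
noncomputable def HOneZero.stepApprox (φ : HOneZero) (k : ℕ) : ℝ≥0 →₀ ℝ :=
  (φ.exists_linearCombination_stepL2_near (ε := (1 / 2) ^ k) (by positivity)).choose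

theorem HOneZero.norm_stepApprox_sub_lt (φ : HOneZero) (k : ℕ) :
    ‖Finsupp.linearCombination ℝ stepL2 (φ.stepApprox k) - φ.derivL2‖ < (1 / 2) ^ k :=
  (φ.exists_linearCombination_stepL2_near (ε := (1 / 2) ^ k) (by positivity)).choose_spec

theorem HOneZero.tendsto_stepApprox (φ : HOneZero) :
    Tendsto (fun k => Finsupp.linearCombination ℝ stepL2 (φ.stepApprox k)) atTop
      (𝓝 φ.derivL2) := by
  rw [tendsto_iff_norm_sub_tendsto_zero]
  exact squeeze_zero (fun _ => norm_nonneg _) (fun k => (φ.norm_stepApprox_sub_lt k).le)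
    (tendsto_pow_atTop_nhds_zero_of_lt_one (by norm_num) (by norm_num))

/-- Scalar coefficients, placed on the `i`-th coordinate axis of `ℝⁿ`. -/
noncomputable def onAxis {n : ℕ} (i : Fin n) :
    (ℝ≥0 →₀ ℝ) →ₗ[ℝ] (ℝ≥0 →₀ EuclideanSpace ℝ (Fin n)) :=
  Finsupp.mapRange.linearMap (LinearMap.toSpanSingleton ℝ _ (EuclideanSpace.single i (1 : ℝ)))

theorem stepSum_onAxis {n : ℕ} (i j : Fin n) (a : ℝ≥0 →₀ ℝ) :
    stepSum n j (onAxis i a) = if j = i then Finsupp.linearCombination ℝ stepL2 a else 0 := by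
  have h : (stepSum n j).comp (onAxis i) =
      if j = i then Finsupp.linearCombination ℝ stepL2 else 0 := by
    refine Finsupp.lhom_ext fun t r => ?_
    split_ifs with hij
    · subst hij
      simp [onAxis, stepSum_single]
    · simp [onAxis, stepSum_single, hij]
  have := LinearMap.congr_fun h a
  rw [LinearMap.comp_apply] at this
  rw [this]
  split_ifs <;> rfl

theorem IsWienerMeasure.map_pathPairing {n : ℕ} {P : Measure (PathSpace n)}
    (hP : IsWienerMeasure P) (b : ℝ≥0 →₀ EuclideanSpace ℝ (Fin n)) :
    P.map (pathPairing n b) = gaussianReal 0 (2 * ∑ i, ‖stepSum n i b‖₊ ^ 2) := by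
  have := hP.isProbabilityMeasure
  have hm : Measurable (pathPairing n b) := (continuous_pathPairing b).measurable
  have := Measure.isProbabilityMeasure_map hm.aemeasurable (μ := P)
  refine Measure.ext_of_charFun (funext fun u => ?_)
  rw [charFun_apply_real, charFun_gaussianReal, integral_map hm.aemeasurable (by fun_prop)]
  have h := hP.integral_cexp_pathPairing (u • b)
  simp only [map_smul, LinearMap.smul_apply, smul_eq_mul, ofReal_mul, norm_smul] at h
  rw [h]
  congr 1
  push_cast
  simp only [mul_pow, ← Finset.mul_sum]
  rw [← ofReal_pow, Real.norm_eq_abs, sq_abs]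
  push_cast
  ring

theorem IsWienerMeasure.eLpNorm_pathPairing {n : ℕ} {P : Measure (PathSpace n)}
    (hP : IsWienerMeasure P) (b : ℝ≥0 →₀ EuclideanSpace ℝ (Fin n)) :
    eLpNorm (pathPairing n b) 2 P = ENNReal.ofReal (√(2 * ∑ i, ‖stepSum n i b‖ ^ 2)) := by
  have hm : Measurable (pathPairing n b) := (continuous_pathPairing b).measurable
  have h1 := eLpNorm_map_measure (p := 2) (μ := P) (g := (id : ℝ → ℝ))
    aestronglyMeasurable_id hm.aemeasurable
  rw [Function.id_comp] at h1
  rw [← h1, hP.map_pathPairing]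
  have h2 := memLp_id_gaussianReal (μ := 0) (v := 2 * ∑ i, ‖stepSum n i b‖₊ ^ 2) 2
  have h2' : MemLp id 2 (gaussianReal 0 (2 * ∑ i, ‖stepSum n i b‖₊ ^ 2)) := by exact_mod_cast h2
  rw [h2'.eLpNorm_eq_integral_rpow_norm (by norm_num) (by norm_num)]
  have h3 := variance_id_gaussianReal (μ := 0) (v := 2 * ∑ i, ‖stepSum n i b‖₊ ^ 2)
  rw [variance_of_integral_eq_zero aemeasurable_id (by simp)] at h3
  rw [Real.sqrt_eq_rpow]
  congr 2
  · simp only [ENNReal.toReal_ofNat, Real.rpow_ofNat, Real.norm_eq_abs, sq_abs]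
    rw [h3]
    push_cast
    rfl
  · norm_num

/-- The approximations of the Paley–Wiener integral of `φ` in the `i`-th coordinate by linear
functionals of finitely many values of the path. -/
noncomputable def HOneZero.paleyWienerApprox {n : ℕ} (φ : HOneZero) (i : Fin n) (k : ℕ) :
    PathSpace n →ₗ[ℝ] ℝ :=
  (1 / 2 : ℝ) • pathPairing n (onAxis i (φ.stepApprox k))

open scoped Classical in
/-- The Paley–Wiener integral `½ ∫₀^∞ φ'(t) dγⁱ(t)`, defined pointwise as the limit of
`paleyWienerApprox` where that limit exists, and as `0` elsewhere. The set of convergence is a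
linear subspace containing all `φ v`, so the integral has directional derivatives along `φ v` at
every path. -/
noncomputable def HOneZero.paleyWiener {n : ℕ} (φ : HOneZero) (i : Fin n) (γ : PathSpace n) : ℝ :=
  if h : ∃ l, Tendsto (fun k => φ.paleyWienerApprox i k γ) atTop (𝓝 l) then h.choose else 0

theorem HOneZero.paleyWiener_eq {n : ℕ} {φ : HOneZero} {i : Fin n} {γ : PathSpace n} {l : ℝ}
    (h : Tendsto (fun k => φ.paleyWienerApprox i k γ) atTop (𝓝 l)) : φ.paleyWiener i γ = l := by
  have h' : ∃ l, Tendsto (fun k => φ.paleyWienerApprox i k γ) atTop (𝓝 l) := ⟨l, h⟩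
  rw [HOneZero.paleyWiener, dif_pos h']
  exact tendsto_nhds_unique h'.choose_spec h

theorem HOneZero.measurable_paleyWienerApprox {n : ℕ} (φ : HOneZero) (i : Fin n) (k : ℕ) :
    Measurable (φ.paleyWienerApprox i k) :=
  ((continuous_pathPairing _).measurable.const_mul (1 / 2 : ℝ))

theorem HOneZero.measurable_paleyWiener {n : ℕ} (φ : HOneZero) (i : Fin n) :
    Measurable (φ.paleyWiener i) := by
  classical
  set A := {γ : PathSpace n | ∃ l, Tendsto (fun k => φ.paleyWienerApprox i k γ) atTop (𝓝 l)}
  have hA : MeasurableSet A :=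
    measurableSet_exists_tendsto (φ.measurable_paleyWienerApprox i)
  refine measurable_of_tendsto_metrizable (f := fun k => A.indicator (φ.paleyWienerApprox i k))
    (fun k => (φ.measurable_paleyWienerApprox i k).indicator hA) ?_
  rw [tendsto_pi_nhds]
  intro γ
  by_cases hγ : γ ∈ A
  · simp only [Set.indicator_of_mem hγ]
    obtain ⟨l, hl⟩ := hγ
    rwa [HOneZero.paleyWiener_eq hl]
  · simp only [Set.indicator_of_notMem hγ]
    have h0 : φ.paleyWiener i γ = 0 := dif_neg hγ
    rw [h0]
    exact tendsto_const_nhds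

theorem IsWienerMeasure.ae_tendsto_paleyWienerApprox {n : ℕ} {P : Measure (PathSpace n)}
    (hP : IsWienerMeasure P) (φ : HOneZero) (i : Fin n) :
    ∀ᵐ γ ∂P, Tendsto (fun k => φ.paleyWienerApprox i k γ) atTop (𝓝 (φ.paleyWiener i γ)) := by
  have h : ∀ᵐ γ ∂P, ∃ l, Tendsto (fun k => φ.paleyWienerApprox i k γ) atTop (𝓝 l) := by
    refine Lp.ae_tendsto_of_cauchy_eLpNorm (p := 2)
      (B := fun N => ENNReal.ofReal (2 * (1 / 2) ^ N))
      (fun k => (φ.measurable_paleyWienerApprox i k).aestronglyMeasurable) (by norm_num)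
      ((summable_geometric_of_lt_one (by norm_num) (by norm_num)).mul_left 2).tsum_ofReal_ne_top
      fun N k m hk hm => ?_
    have e : (φ.paleyWienerApprox i k - φ.paleyWienerApprox i m : PathSpace n → ℝ) =
        pathPairing n (onAxis i ((1 / 2 : ℝ) • (φ.stepApprox k - φ.stepApprox m))) := by
      funext γ
      simp only [HOneZero.paleyWienerApprox, Pi.sub_apply, map_smul, map_sub,
        LinearMap.smul_apply, LinearMap.sub_apply, smul_sub]
    rw [e, hP.eLpNorm_pathPairing]
    refine (ENNReal.ofReal_lt_ofReal_iff (by positivity)).2 ?_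
    simp only [stepSum_onAxis, apply_ite norm, ite_pow, norm_zero]
    rw [Finset.sum_eq_single i (fun j _ hj => by simp [hj]) (by simp), if_pos rfl, map_smul,
      norm_smul, map_sub]
    have h1 := φ.norm_stepApprox_sub_lt k
    have h2 := φ.norm_stepApprox_sub_lt m
    have h3 : ((1 : ℝ) / 2) ^ k ≤ (1 / 2) ^ N :=
      pow_le_pow_of_le_one (by norm_num) (by norm_num) hk
    have h4 : ((1 : ℝ) / 2) ^ m ≤ (1 / 2) ^ N :=
      pow_le_pow_of_le_one (by norm_num) (by norm_num) hm
    rw [norm_sub_rev] at h2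
    have h5 := norm_sub_le_norm_sub_add_norm_sub
      (Finsupp.linearCombination ℝ stepL2 (φ.stepApprox k)) φ.derivL2
      (Finsupp.linearCombination ℝ stepL2 (φ.stepApprox m))
    set d := ‖Finsupp.linearCombination ℝ stepL2 (φ.stepApprox k) -
      Finsupp.linearCombination ℝ stepL2 (φ.stepApprox m)‖
    have hd : 0 ≤ d := norm_nonneg _
    refine lt_of_le_of_lt (Real.sqrt_le_iff.2 ⟨hd, ?_⟩) (by linarith : d < _)
    rw [Real.norm_of_nonneg (by norm_num)]
    nlinarith [sq_nonneg d]
  filter_upwards [h] with γ hγ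
  obtain ⟨l, hl⟩ := hγ
  rwa [HOneZero.paleyWiener_eq hl]

theorem HOneZero.tendsto_paleyWienerApprox_path {n : ℕ} (φ : HOneZero) (i j : Fin n) :
    Tendsto (fun k => φ.paleyWienerApprox i k (φ.path (EuclideanSpace.single j 1))) atTop
      (𝓝 (if i = j then φ.normSq / 2 else 0)) := by
  simp only [HOneZero.paleyWienerApprox, LinearMap.smul_apply, pathPairing_path_single,
    stepSum_onAxis, smul_eq_mul]
  by_cases h : i = j
  · subst h
    simp only [if_true]
    have h1 := (φ.tendsto_stepApprox.inner (tendsto_const_nhds (x := φ.derivL2))).const_mul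
      (1 / 2 : ℝ)
    rw [real_inner_self_eq_norm_sq, φ.norm_derivL2_sq] at h1
    convert h1 using 2
    ring
  · simp [h, Ne.symm h]

theorem HOneZero.paleyWiener_add_smul {n : ℕ} {φ : HOneZero} {i j : Fin n} {γ : PathSpace n}
    (h : ∃ l, Tendsto (fun k => φ.paleyWienerApprox i k γ) atTop (𝓝 l)) (s : ℝ) :
    φ.paleyWiener i (γ + s • φ.path (EuclideanSpace.single j 1)) =
      φ.paleyWiener i γ + s * (if i = j then φ.normSq / 2 else 0) := by
  obtain ⟨l, hl⟩ := h
  rw [HOneZero.paleyWiener_eq hl]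
  refine HOneZero.paleyWiener_eq ?_
  simp only [map_add, map_smul, smul_eq_mul]
  exact hl.add ((φ.tendsto_paleyWienerApprox_path i j).const_mul s)

theorem HOneZero.paleyWiener_add_smul_of_not_exists {n : ℕ} {φ : HOneZero} {i j : Fin n}
    {γ : PathSpace n} (h : ¬ ∃ l, Tendsto (fun k => φ.paleyWienerApprox i k γ) atTop (𝓝 l))
    (s : ℝ) : φ.paleyWiener i (γ + s • φ.path (EuclideanSpace.single j 1)) = 0 := by
  rw [HOneZero.paleyWiener, dif_neg]
  rintro ⟨l, hl⟩
  refine h ⟨_, (hl.sub ((φ.tendsto_paleyWienerApprox_path i j).const_mul s)).congr fun k => ?_⟩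
  simp only [map_add, map_smul, smul_eq_mul]
  ring

/-- The Paley–Wiener integrals are affine along the directions `φ eⱼ`, with a constant slope off a
null set. -/
theorem IsWienerMeasure.exists_hasLineDerivAt_paleyWiener {n : ℕ} {P : Measure (PathSpace n)}
    (hP : IsWienerMeasure P) (φ : HOneZero) (i j : Fin n) :
    ∃ D : PathSpace n → ℝ, (D =ᵐ[P] fun _ => if i = j then φ.normSq / 2 else 0) ∧
      ∀ γ, HasLineDerivAt ℝ (φ.paleyWiener i) (D γ) γ (φ.path (EuclideanSpace.single j 1)) := by
  classical
  refine ⟨fun γ => if ∃ l, Tendsto (fun k => φ.paleyWienerApprox i k γ) atTop (𝓝 l) then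
    (if i = j then φ.normSq / 2 else 0) else 0, ?_, fun γ => ?_⟩
  · filter_upwards [hP.ae_tendsto_paleyWienerApprox φ i] with γ hγ
    rw [if_pos ⟨_, hγ⟩]
  · unfold HasLineDerivAt
    by_cases h : ∃ l, Tendsto (fun k => φ.paleyWienerApprox i k γ) atTop (𝓝 l)
    · simp only [if_pos h, HOneZero.paleyWiener_add_smul h]
      simpa using ((hasDerivAt_id (0 : ℝ)).mul_const
        (if i = j then φ.normSq / 2 else 0)).const_add (φ.paleyWiener i γ)
    · simp only [if_neg h, HOneZero.paleyWiener_add_smul_of_not_exists h]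
      exact hasDerivAt_const _ _

/-- The joint characteristic function of the Paley–Wiener integral and a linear functional of the
path: the covariance of the two is the value of the functional on the direction `φ eᵢ`. -/
theorem IsWienerMeasure.integral_cexp_paleyWiener_add_pathPairing {n : ℕ}
    {P : Measure (PathSpace n)} (hP : IsWienerMeasure P) (φ : HOneZero) (i : Fin n) (u : ℝ)
    (b : ℝ≥0 →₀ EuclideanSpace ℝ (Fin n)) :
    ∫ γ, cexp ((u * φ.paleyWiener i γ + pathPairing n b γ : ℝ) * I) ∂P =
      cexp (-((∑ j, ‖stepSum n j b‖ ^ 2) +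
        u * pathPairing n b (φ.path (EuclideanSpace.single i 1)) +
          u ^ 2 * (φ.normSq / 4) : ℝ)) := by
  have := hP.isProbabilityMeasure
  have h1 : Tendsto
      (fun k => ∫ γ, cexp ((u * φ.paleyWienerApprox i k γ + pathPairing n b γ : ℝ) * I) ∂P) atTop
      (𝓝 (∫ γ, cexp ((u * φ.paleyWiener i γ + pathPairing n b γ : ℝ) * I) ∂P)) := by
    refine tendsto_integral_of_dominated_convergence (fun _ => 1) (fun k => ?_)
      (integrable_const 1) (fun k => ae_of_all _ fun γ => ?_) ?_
    · have h2 := φ.measurable_paleyWienerApprox i k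
      have h3 := (continuous_pathPairing b).measurable
      exact Measurable.aestronglyMeasurable (by fun_prop)
    · rw [norm_exp_ofReal_mul_I]
    · filter_upwards [hP.ae_tendsto_paleyWienerApprox φ i] with γ hγ
      have hc : Continuous fun x : ℝ => cexp ((u * x + pathPairing n b γ : ℝ) * I) := by fun_prop
      exact (hc.tendsto _).comp hγ
  refine tendsto_nhds_unique h1 ?_
  have h4 : ∀ k, ∫ γ, cexp ((u * φ.paleyWienerApprox i k γ + pathPairing n b γ : ℝ) * I) ∂P =
      cexp (-((∑ j, ‖stepSum n j b‖ ^ 2) +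
        u * ⟪stepSum n i b, Finsupp.linearCombination ℝ stepL2 (φ.stepApprox k)⟫ +
          u ^ 2 * (‖Finsupp.linearCombination ℝ stepL2 (φ.stepApprox k)‖ ^ 2 / 4) : ℝ)) := by
    intro k
    have h := hP.integral_cexp_pathPairing (b + (u / 2) • onAxis i (φ.stepApprox k))
    have e : ∀ γ, pathPairing n (b + (u / 2) • onAxis i (φ.stepApprox k)) γ =
        u * φ.paleyWienerApprox i k γ + pathPairing n b γ := by
      intro γ
      simp only [HOneZero.paleyWienerApprox, map_add, map_smul, LinearMap.add_apply,
        LinearMap.smul_apply, smul_eq_mul]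
      ring
    simp_rw [e] at h
    rw [h]
    congr 3
    set g := Finsupp.linearCombination ℝ stepL2 (φ.stepApprox k)
    have e2 : ∀ j, ‖stepSum n j (b + (u / 2) • onAxis i (φ.stepApprox k))‖ ^ 2 =
        ‖stepSum n j b‖ ^ 2 + if j = i then u * ⟪stepSum n i b, g⟫ + u ^ 2 * (‖g‖ ^ 2 / 4)
          else 0 := by
      intro j
      rw [map_add, map_smul, stepSum_onAxis]
      split_ifs with hj
      · subst hj
        rw [norm_add_sq_real, real_inner_smul_right, norm_smul, Real.norm_eq_abs, mul_pow, sq_abs]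
        ring
      · simp
    simp_rw [e2]
    rw [Finset.sum_add_distrib, Finset.sum_ite_eq' Finset.univ i, if_pos (Finset.mem_univ i)]
    ring
  simp_rw [h4]
  rw [pathPairing_path_single, ← φ.norm_derivL2_sq]
  have hc : Continuous fun g : HalfLineL2 => cexp (-((∑ j, ‖stepSum n j b‖ ^ 2) +
        u * ⟪stepSum n i b, g⟫ + u ^ 2 * (‖g‖ ^ 2 / 4) : ℝ)) := by fun_prop
  exact (hc.tendsto _).comp φ.tendsto_stepApprox

end PaleyWiener

/-! ### Integration by parts on path space -/

section IntegrationByParts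

open Complex ProbabilityTheory

theorem HOneZero.normSq_nonneg (φ : HOneZero) : 0 ≤ φ.normSq := by
  rw [← φ.norm_derivL2_sq]
  positivity

theorem HOneZero.path_eq_zero {n : ℕ} {φ : HOneZero} (h : φ.normSq = 0)
    (v : EuclideanSpace ℝ (Fin n)) : φ.path v = 0 := by
  have h0 : φ.derivL2 = 0 := by
    rw [← φ.norm_derivL2_sq] at h
    simpa using h
  refine Subtype.ext (ContinuousMap.ext fun t => ?_)
  change φ.toFun t • v = 0
  rw [← φ.inner_stepL2_derivL2, h0, inner_zero_right, zero_smul]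

/-- The variance `‖φ‖² / 2` of the Paley–Wiener integral of `φ`. -/
noncomputable def HOneZero.halfNormSq (φ : HOneZero) : ℝ≥0 := ⟨φ.normSq / 2, by
  have := φ.normSq_nonneg
  positivity⟩

theorem HOneZero.coe_halfNormSq (φ : HOneZero) : (φ.halfNormSq : ℝ) = φ.normSq / 2 := rfl

theorem IsWienerMeasure.map_paleyWiener {n : ℕ} {P : Measure (PathSpace n)}
    (hP : IsWienerMeasure P) (φ : HOneZero) (i : Fin n) :
    P.map (φ.paleyWiener i) = gaussianReal 0 φ.halfNormSq := by
  have := hP.isProbabilityMeasure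
  have hX := φ.measurable_paleyWiener i
  have := Measure.isProbabilityMeasure_map hX.aemeasurable (μ := P)
  refine Measure.ext_of_charFun (funext fun u => ?_)
  rw [charFun_apply_real, charFun_gaussianReal, integral_map hX.aemeasurable (by fun_prop)]
  have h := hP.integral_cexp_paleyWiener_add_pathPairing φ i u 0
  simp only [map_zero, LinearMap.zero_apply, add_zero, ofReal_mul] at h
  rw [h, φ.coe_halfNormSq]
  congr 1
  push_cast
  simp
  ring

theorem IsWienerMeasure.paleyWiener_ae_eq_zero {n : ℕ} {P : Measure (PathSpace n)}
    (hP : IsWienerMeasure P) {φ : HOneZero} (hφ : φ.normSq = 0) (i : Fin n) :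
    ∀ᵐ γ ∂P, φ.paleyWiener i γ = 0 := by
  have h := hP.map_paleyWiener φ i
  have h0 : φ.halfNormSq = 0 := NNReal.eq (by rw [φ.coe_halfNormSq, hφ]; simp)
  rw [h0, gaussianReal_zero_var] at h
  refine ae_of_ae_map (φ.measurable_paleyWiener i).aemeasurable (p := fun x => x = 0) ?_
  rw [h]
  exact (ae_dirac_iff (measurableSet_singleton (0 : ℝ))).2 rfl

/-- The component of a path that is left after removing its Paley–Wiener integral in the direction
`φ eᵢ`. -/
noncomputable def HOneZero.residual {n : ℕ} (φ : HOneZero) (i : Fin n) (γ : PathSpace n) :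
    PathSpace n :=
  γ + (-(φ.paleyWiener i γ / φ.halfNormSq)) • φ.path (EuclideanSpace.single i 1)

instance continuousAdd_pathSpace (n : ℕ) : ContinuousAdd (PathSpace n) :=
  (Submodule.topologicalAddGroup (basedPaths n)).toContinuousAdd

theorem HOneZero.measurable_residual {n : ℕ} (φ : HOneZero) (i : Fin n) :
    Measurable (φ.residual i) := by
  have h := φ.measurable_paleyWiener i
  have h2 : Continuous fun p : PathSpace n × ℝ =>
      p.1 + (-(p.2 / φ.halfNormSq)) • φ.path (EuclideanSpace.single i 1) :=
    continuous_fst.add ((continuous_snd.div_const _).neg.smul continuous_const)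
  exact h2.measurable.comp (measurable_id.prodMk h)

/-- The Cameron–Martin theorem in disintegrated form: the Paley–Wiener integral is Gaussian and
independent of the residual path, because the two are jointly Gaussian and uncorrelated. -/
theorem IsWienerMeasure.measurePreserving_paleyWiener_residual {n : ℕ} {P : Measure (PathSpace n)}
    (hP : IsWienerMeasure P) {φ : HOneZero} (hφ : φ.normSq ≠ 0) (i : Fin n) :
    MeasurePreserving (fun γ => (φ.paleyWiener i γ, φ.residual i γ)) P
      ((gaussianReal 0 φ.halfNormSq).prod (P.map (φ.residual i))) := by
  have := hP.isProbabilityMeasure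
  have hX := φ.measurable_paleyWiener i
  have hY := φ.measurable_residual i
  have hXY : Measurable fun γ => (φ.paleyWiener i γ, φ.residual i γ) := hX.prodMk hY
  have := Measure.isProbabilityMeasure_map hY.aemeasurable (μ := P)
  have := Measure.isProbabilityMeasure_map hXY.aemeasurable (μ := P)
  refine ⟨hXY, measure_ext_of_integral_cexp_pathPairing fun u b => ?_⟩
  have hb : Measurable (pathPairing n b) := (continuous_pathPairing b).measurable
  set h := φ.path (EuclideanSpace.single i (1 : ℝ)) with hh
  set c : ℝ := φ.normSq / 2 with hc
  have hc0 : c ≠ 0 := div_ne_zero hφ two_ne_zero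
  -- the joint characteristic function factorizes; it is used at `u` and, for the marginal law of
  -- the residual, at frequency `0`
  have key : ∀ u : ℝ, ∫ γ, cexp ((u * φ.paleyWiener i γ + pathPairing n b (φ.residual i γ) : ℝ) * I)
      ∂P = cexp (-((∑ j, ‖stepSum n j b‖ ^ 2) - (pathPairing n b h) ^ 2 / (2 * c) : ℝ)) *
        cexp (-(u ^ 2 * c / 2 : ℝ)) := by
    intro u
    have e : ∀ γ, u * φ.paleyWiener i γ + pathPairing n b (φ.residual i γ) =
        (u - pathPairing n b h / c) * φ.paleyWiener i γ + pathPairing n b γ := by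
      intro γ
      rw [HOneZero.residual, map_add, map_smul, φ.coe_halfNormSq, ← hh, ← hc, smul_eq_mul]
      ring
    simp_rw [e]
    rw [hP.integral_cexp_paleyWiener_add_pathPairing, ← Complex.exp_add, ← hh, ← ofReal_neg,
      ← ofReal_neg, ← ofReal_neg, ← ofReal_add]
    congr 2
    have : φ.normSq / 4 = c / 2 := by rw [hc]; ring
    rw [this]
    field_simp
    ring
  have e1 : ∫ z, cexp ((u * z.1 + pathPairing n b z.2 : ℝ) * I)
      ∂P.map (fun γ => (φ.paleyWiener i γ, φ.residual i γ)) =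
      ∫ γ, cexp ((u * φ.paleyWiener i γ + pathPairing n b (φ.residual i γ) : ℝ) * I) ∂P := by
    rw [integral_map hXY.aemeasurable]
    exact Measurable.aestronglyMeasurable (by fun_prop)
  have e2 : ∫ y, cexp (pathPairing n b y * I) ∂P.map (φ.residual i) =
      ∫ γ, cexp (((0 : ℝ) * φ.paleyWiener i γ + pathPairing n b (φ.residual i γ) : ℝ) * I) ∂P := by
    rw [integral_map hY.aemeasurable]
    · simp
    · exact Measurable.aestronglyMeasurable (by fun_prop)
  have e3 : ∀ z : ℝ × PathSpace n, cexp ((u * z.1 + pathPairing n b z.2 : ℝ) * I) =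
      cexp (u * z.1 * I) * cexp (pathPairing n b z.2 * I) := by
    intro z
    rw [← Complex.exp_add]
    congr 1
    push_cast
    ring
  have e4 : ∫ x, cexp (u * x * I) ∂gaussianReal 0 φ.halfNormSq = cexp (-(u ^ 2 * c / 2 : ℝ)) := by
    rw [← charFun_apply_real, charFun_gaussianReal]
    congr 1
    rw [φ.coe_halfNormSq, ← hc]
    push_cast
    ring
  rw [e1, key]
  simp_rw [e3]
  rw [integral_prod_mul (fun x : ℝ => cexp (u * x * I)) (fun y => cexp (pathPairing n b y * I)),
    e4, e2, key]
  simp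
  ring

variable {n : ℕ} {P : Measure (PathSpace n)} {φ : HOneZero} {G G' : PathSpace n → ℝ} {i : Fin n}

/-- Integrability and integration by parts together. On the product space provided by
`IsWienerMeasure.measurePreserving_paleyWiener_residual` both are statements about one Gaussian
variable with the residual path as a parameter. -/
theorem IsWienerMeasure.integrable_and_integral_mul_paleyWiener (hP : IsWienerMeasure P)
    (hG : ∀ γ, HasLineDerivAt ℝ G (G' γ) γ (φ.path (EuclideanSpace.single i 1)))
    (hGi : Integrable G P) (hG'i : Integrable G' P) :
    Integrable (fun γ => G γ * φ.paleyWiener i γ) P ∧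
      ∫ γ, G γ * φ.paleyWiener i γ ∂P = ∫ γ, G' γ ∂P := by
  have := hP.isProbabilityMeasure
  by_cases hφ : φ.normSq = 0
  · -- the direction `φ eᵢ` is zero, and the Paley–Wiener integral vanishes almost surely
    have h0 : ∀ γ, G' γ = 0 := by
      intro γ
      have h1 := hG γ
      rw [HOneZero.path_eq_zero hφ] at h1
      exact h1.unique hasLineDerivAt_zero
    have h1 : ∀ᵐ γ ∂P, G γ * φ.paleyWiener i γ = 0 := by
      filter_upwards [hP.paleyWiener_ae_eq_zero hφ i] with γ hγ
      rw [hγ, mul_zero]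
    refine ⟨(integrable_zero _ _ _).congr (h1.mono fun γ h => h.symm), ?_⟩
    rw [integral_congr_ae h1]
    simp [h0]
  · have hXY := hP.measurePreserving_paleyWiener_residual hφ i
    have hY := φ.measurable_residual i
    have := Measure.isProbabilityMeasure_map hY.aemeasurable (μ := P)
    set h := φ.path (EuclideanSpace.single i (1 : ℝ)) with hh
    set ν := P.map (φ.residual i)
    set c := φ.halfNormSq with hc
    have hcpos : (c : ℝ) ≠ 0 := by
      rw [hc, φ.coe_halfNormSq]; exact div_ne_zero hφ two_ne_zero
    have hc0 : c ≠ 0 := by exact_mod_cast hcpos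
    let T : ℝ × PathSpace n → PathSpace n := fun z => z.2 + (z.1 / c) • h
    have hT : Measurable T := by
      have : Continuous T :=
        continuous_snd.add ((continuous_fst.div_const _).smul continuous_const)
      exact this.measurable
    have hTXY : ∀ γ, T (φ.paleyWiener i γ, φ.residual i γ) = γ := fun γ => by
      simp only [T, HOneZero.residual, ← hh, ← hc, add_assoc, ← add_smul, neg_add_cancel,
        zero_smul, add_zero]
    have hTmp : MeasurePreserving T ((gaussianReal 0 c).prod ν) P := by
      refine ⟨hT, ?_⟩
      rw [← hXY.map_eq, Measure.map_map hT hXY.measurable]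
      have : T ∘ (fun γ => (φ.paleyWiener i γ, φ.residual i γ)) = id := funext hTXY
      rw [this, Measure.map_id]
    have hGT : Integrable (fun z => G (T z)) ((gaussianReal 0 c).prod ν) :=
      hTmp.integrable_comp_of_integrable hGi
    have hG'T : Integrable (fun z => G' (T z)) ((gaussianReal 0 c).prod ν) :=
      hTmp.integrable_comp_of_integrable hG'i
    have hd : ∀ y x, HasDerivAt (fun x => G (T (x, y))) ((c : ℝ)⁻¹ * G' (T (x, y))) x := by
      intro y x
      have h1 := hG (T (x, y))
      unfold HasLineDerivAt at h1
      have h2 : HasDerivAt (fun x' : ℝ => (x' - x) / c) (c : ℝ)⁻¹ x := by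
        simpa using ((hasDerivAt_id x).sub_const x).div_const (c : ℝ)
      have h3 : HasDerivAt (fun t : ℝ => G (T (x, y) + t • h)) (G' (T (x, y)))
          ((fun x' : ℝ => (x' - x) / c) x) := by simpa using h1
      have h4 := h3.comp x h2
      rw [mul_comm] at h4
      refine h4.congr_of_eventuallyEq (Filter.Eventually.of_forall fun x' => ?_)
      simp only [T, Function.comp_apply, add_assoc, ← add_smul]
      congr 3
      ring
    have hprod : Integrable (fun z : ℝ × PathSpace n => z.1 * G (T z))
        ((gaussianReal 0 c).prod ν) := by
      refine (integrable_prod_iff' (measurable_fst.aestronglyMeasurable.mul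
        hGT.aestronglyMeasurable)).2 ⟨?_, ?_⟩
      · filter_upwards [hGT.prod_left_ae, hG'T.prod_left_ae] with y h1 h2
        exact integrable_id_mul_gaussianReal hc0 (hd y) h1 (h2.const_mul _)
      · refine Integrable.mono' (g := fun y => (c + 1) * (1 + ∫ x, ‖G (T (x, y))‖ ∂gaussianReal 0 c)
          + ∫ x, ‖G' (T (x, y))‖ ∂gaussianReal 0 c) ?_ ?_ ?_
        · exact ((((integrable_const 1).add hGT.integral_norm_prod_right).const_mul _).add
            hG'T.integral_norm_prod_right)
        · exact ((measurable_fst.aestronglyMeasurable.mul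
            hGT.aestronglyMeasurable).norm).prod_swap.integral_prod_right'
        · filter_upwards [hGT.prod_left_ae, hG'T.prod_left_ae] with y h1 h2
          rw [Real.norm_of_nonneg (integral_nonneg fun _ => norm_nonneg _)]
          refine (integral_abs_id_mul_gaussianReal_le hc0 (hd y) h1 (h2.const_mul _)).trans_eq ?_
          simp only [abs_mul, integral_const_mul, abs_inv, NNReal.abs_eq, Real.norm_eq_abs]
          field_simp
    have e : ∀ γ, G γ * φ.paleyWiener i γ = (fun z : ℝ × PathSpace n => z.1 * G (T z))
        (φ.paleyWiener i γ, φ.residual i γ) := fun γ => by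
      simp only [hTXY]; ring
    have e' : ∀ γ, G' γ = (fun z : ℝ × PathSpace n => G' (T z))
        (φ.paleyWiener i γ, φ.residual i γ) := fun γ => by
      simp only [hTXY]
    refine ⟨(hXY.integrable_comp_of_integrable hprod).congr (ae_of_all _ fun γ => (e γ).symm), ?_⟩
    have i1 : ∫ γ, G γ * φ.paleyWiener i γ ∂P =
        ∫ z, z.1 * G (T z) ∂((gaussianReal 0 c).prod ν) := by
      rw [integral_congr_ae (ae_of_all _ e), ← hXY.map_eq, integral_map hXY.measurable.aemeasurable]
      rw [hXY.map_eq]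
      exact hprod.aestronglyMeasurable
    have i2 : ∫ γ, G' γ ∂P = ∫ z, G' (T z) ∂((gaussianReal 0 c).prod ν) := by
      rw [integral_congr_ae (ae_of_all _ e'), ← hXY.map_eq,
        integral_map hXY.measurable.aemeasurable]
      rw [hXY.map_eq]
      exact hG'T.aestronglyMeasurable
    rw [i1, i2, integral_prod_symm _ hprod, integral_prod_symm _ hG'T]
    refine integral_congr_ae ?_
    filter_upwards [hGT.prod_left_ae, hG'T.prod_left_ae] with y h1 h2
    rw [integral_id_mul_gaussianReal hc0 (hd y) h1 (h2.const_mul _), integral_const_mul,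
      mul_inv_cancel_left₀ hcpos]

end IntegrationByParts

/-! ### The moments of the Paley–Wiener integrals and the covariance matrix -/

section Covariance

variable {n : ℕ} {P : Measure (PathSpace n)} {F : PathSpace n → ℝ} {φ : HOneZero}

theorem HasPhiGradient.hasLineDerivAt (h : HasPhiGradient F φ) (i : Fin n) (γ : PathSpace n) :
    HasLineDerivAt ℝ F (phiGradient F φ γ i) γ (φ.path (EuclideanSpace.single i 1)) :=
  (h γ _).lineDifferentiableAt.hasLineDerivAt

theorem HasPhiHessian.hasLineDerivAt (h : HasPhiHessian F φ) (i j : Fin n) (γ : PathSpace n) :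
    HasLineDerivAt ℝ (fun η => phiGradient F φ η j) (phiHessian F φ γ i j) γ
      (φ.path (EuclideanSpace.single i 1)) :=
  (h γ _ _).lineDifferentiableAt.hasLineDerivAt

theorem integrable_phiGradient_apply (h : Integrable (phiGradient F φ) P) (i : Fin n) :
    Integrable (fun γ => phiGradient F φ γ i) P :=
  (EuclideanSpace.proj (𝕜 := ℝ) i : EuclideanSpace ℝ (Fin n) →L[ℝ] ℝ).integrable_comp h

theorem integral_phiGradient_apply (h : Integrable (phiGradient F φ) P) (i : Fin n) :
    (∫ γ, phiGradient F φ γ ∂P) i = ∫ γ, phiGradient F φ γ i ∂P :=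
  ((EuclideanSpace.proj (𝕜 := ℝ) i : EuclideanSpace ℝ (Fin n) →L[ℝ] ℝ).integral_comp_comm h).symm

/-- The expected `φ`-Hessian is the second moment matrix of the Paley–Wiener integrals with weight
`F`, up to the multiple of the identity that comes from differentiating these integrals. -/
theorem IsWienerMeasure.integrable_and_integral_mul_paleyWiener_mul (hP : IsWienerMeasure P)
    (hF_int : Integrable F P) (h_grad : HasPhiGradient F φ)
    (h_grad_int : Integrable (phiGradient F φ) P) (h_hess : HasPhiHessian F φ)
    (h_hess_int : ∀ i j, Integrable (fun γ => phiHessian F φ γ i j) P) (i j : Fin n) :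
    Integrable (fun γ => F γ * φ.paleyWiener i γ * φ.paleyWiener j γ) P ∧
      ∫ γ, F γ * φ.paleyWiener i γ * φ.paleyWiener j γ ∂P =
        (∫ γ, phiHessian F φ γ i j ∂P) + (if i = j then φ.normSq / 2 else 0) * ∫ γ, F γ ∂P := by
  obtain ⟨D, hD, hD'⟩ := hP.exists_hasLineDerivAt_paleyWiener φ i j
  obtain ⟨h1, -⟩ := hP.integrable_and_integral_mul_paleyWiener (h_grad.hasLineDerivAt i) hF_int
    (integrable_phiGradient_apply h_grad_int i)
  obtain ⟨h2, h2'⟩ := hP.integrable_and_integral_mul_paleyWiener (h_hess.hasLineDerivAt i j)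
    (integrable_phiGradient_apply h_grad_int j) (h_hess_int i j)
  have h3 : Integrable (fun γ => F γ * D γ) P := by
    refine (hF_int.mul_const (if i = j then φ.normSq / 2 else 0)).congr ?_
    filter_upwards [hD] with γ hγ
    rw [hγ]
  have hprod : ∀ γ, HasLineDerivAt ℝ (fun γ => F γ * φ.paleyWiener i γ)
      (phiGradient F φ γ j * φ.paleyWiener i γ + F γ * D γ) γ
      (φ.path (EuclideanSpace.single j 1)) := by
    intro γ
    have := HasDerivAt.mul (h_grad.hasLineDerivAt j γ) (hD' γ)
    simp only [zero_smul, add_zero] at this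
    exact this
  obtain ⟨h4, h4'⟩ := hP.integrable_and_integral_mul_paleyWiener hprod h1 (h2.add h3)
  refine ⟨h4, ?_⟩
  rw [h4', integral_add h2 h3, h2']
  congr 1
  rw [mul_comm, ← integral_mul_const]
  refine integral_congr_ae ?_
  filter_upwards [hD] with γ hγ
  rw [hγ]

/-- The covariance matrix of random variables `X i` under the probability measure `f dμ / ∫ f dμ`
is positive semidefinite. -/
theorem posSemidef_covariance_of_weight {Ω ι : Type*} [Fintype ι] [MeasurableSpace Ω]
    {μ : Measure Ω} {f : Ω → ℝ} {X : ι → Ω → ℝ} (hf : ∀ ω, 0 ≤ f ω) (hfi : Integrable f μ)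
    (hpos : 0 < ∫ ω, f ω ∂μ) (h1 : ∀ i, Integrable (fun ω => f ω * X i ω) μ)
    (h2 : ∀ i j, Integrable (fun ω => f ω * X i ω * X j ω) μ) :
    (Matrix.of fun i j => (∫ ω, f ω ∂μ)⁻¹ * (∫ ω, f ω * X i ω * X j ω ∂μ) -
      ((∫ ω, f ω ∂μ) ^ 2)⁻¹ *
        ((∫ ω, f ω * X i ω ∂μ) * (∫ ω, f ω * X j ω ∂μ))).PosSemidef := by
  set m := ∫ ω, f ω ∂μ with hm
  set a : ι → ℝ := fun i => ∫ ω, f ω * X i ω ∂μ with ha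
  refine Matrix.PosSemidef.of_dotProduct_mulVec_nonneg ?_ fun v => ?_
  · ext i j
    simp only [Matrix.conjTranspose_apply, Matrix.of_apply, star_trivial]
    congr 2
    · exact integral_congr_ae (ae_of_all _ fun ω => by simp only []; ring)
    · ring
  · -- the quadratic form is the integral of `f` times a square
    set A := ∑ i, v i * a i with hA
    have hsq : ∀ ω, f ω * (∑ i, v i * X i ω - m⁻¹ * A) ^ 2 =
        (∑ i, ∑ j, v i * v j * (f ω * X i ω * X j ω)) -
          2 * (m⁻¹ * A) * (∑ i, v i * (f ω * X i ω)) + (m⁻¹ * A) ^ 2 * f ω := by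
      intro ω
      have e1 : ∑ i, ∑ j, v i * v j * (f ω * X i ω * X j ω) =
          f ω * (∑ i, v i * X i ω) ^ 2 := by
        rw [sq, Finset.sum_mul_sum, Finset.mul_sum]
        refine Finset.sum_congr rfl fun i _ => ?_
        rw [Finset.mul_sum]
        exact Finset.sum_congr rfl fun j _ => by ring
      have e2 : ∑ i, v i * (f ω * X i ω) = f ω * ∑ i, v i * X i ω := by
        rw [Finset.mul_sum]
        exact Finset.sum_congr rfl fun j _ => by ring
      rw [e1, e2]
      ring
    have i2 : Integrable (fun ω => ∑ i, ∑ j, v i * v j * (f ω * X i ω * X j ω)) μ :=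
      integrable_finsetSum _ fun i _ => integrable_finsetSum _ fun j _ => (h2 i j).const_mul _
    have i1 : Integrable (fun ω => ∑ i, v i * (f ω * X i ω)) μ :=
      integrable_finsetSum _ fun i _ => (h1 i).const_mul _
    have hint : ∫ ω, f ω * (∑ i, v i * X i ω - m⁻¹ * A) ^ 2 ∂μ =
        (∑ i, ∑ j, v i * v j * ∫ ω, f ω * X i ω * X j ω ∂μ) - 2 * (m⁻¹ * A) * A +
          (m⁻¹ * A) ^ 2 * m := by
      have i3 : Integrable (fun ω => (∑ i, ∑ j, v i * v j * (f ω * X i ω * X j ω)) -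
          2 * (m⁻¹ * A) * (∑ i, v i * (f ω * X i ω))) μ := i2.sub (i1.const_mul _)
      simp_rw [hsq]
      rw [integral_add i3 (hfi.const_mul _),
        integral_sub i2 (i1.const_mul _), integral_const_mul, integral_const_mul,
        integral_finsetSum _ fun i _ => (h1 i).const_mul _,
        integral_finsetSum _ fun i _ => integrable_finsetSum _ fun j _ => (h2 i j).const_mul _]
      simp_rw [integral_const_mul]
      congr 2
      refine Finset.sum_congr rfl fun i _ => ?_
      rw [integral_finsetSum _ fun j _ => (h2 i j).const_mul _]
      simp_rw [integral_const_mul]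
    have hnn : 0 ≤ ∫ ω, f ω * (∑ i, v i * X i ω - m⁻¹ * A) ^ 2 ∂μ :=
      integral_nonneg fun ω => mul_nonneg (hf ω) (sq_nonneg _)
    have hform : star v ⬝ᵥ (Matrix.of fun i j => m⁻¹ * (∫ ω, f ω * X i ω * X j ω ∂μ) -
        (m ^ 2)⁻¹ * (a i * a j)) *ᵥ v =
        m⁻¹ * ((∑ i, ∑ j, v i * v j * ∫ ω, f ω * X i ω * X j ω ∂μ) - m⁻¹ * A ^ 2) := by
      have e3 : A ^ 2 = ∑ i, ∑ j, v i * v j * (a i * a j) := by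
        rw [sq, hA, Finset.sum_mul_sum]
        exact Finset.sum_congr rfl fun i _ => Finset.sum_congr rfl fun j _ => by ring
      rw [e3]
      simp only [dotProduct, Matrix.mulVec, Matrix.of_apply, star_trivial, Finset.mul_sum,
        ← Finset.sum_sub_distrib]
      refine Finset.sum_congr rfl fun i _ => Finset.sum_congr rfl fun j _ => ?_
      rw [sq, mul_inv]
      ring
    rw [hform]
    rw [hint] at hnn
    refine mul_nonneg (inv_nonneg.2 hpos.le) ?_
    have : (m⁻¹ * A) ^ 2 * m = m⁻¹ * A ^ 2 := by field_simp
    rw [this] at hnn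
    linarith

end Covariance

theorem mainTheorem5 (n : ℕ) (P : Measure (PathSpace n)) (hP : IsWienerMeasure P)
    (F : PathSpace n → ℝ) (hF_nonneg : ∀ γ, 0 ≤ F γ) (hF_int : Integrable F P)
    (hF_pos : 0 < ∫ γ, F γ ∂P)
    (φ : HOneZero)
    (h_grad : HasPhiGradient F φ) (h_grad_int : Integrable (phiGradient F φ) P)
    (h_hess : HasPhiHessian F φ)
    (h_hess_int : ∀ i j, Integrable (fun γ => phiHessian F φ γ i j) P) :
    ((∫ γ, F γ ∂P)⁻¹ • matrixExpectation P (phiHessian F φ)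
        - ((∫ γ, F γ ∂P) ^ 2)⁻¹ •
            Matrix.vecMulVec (∫ γ, phiGradient F φ γ ∂P).ofLp (∫ γ, phiGradient F φ γ ∂P).ofLp
        + (φ.normSq / 2) • (1 : Matrix (Fin n) (Fin n) ℝ)).PosSemidef
    ∧ 0 ≤ (∫ γ, phiLaplacian F φ γ ∂P) / (∫ γ, F γ ∂P)
        - ‖∫ γ, phiGradient F φ γ ∂P‖ ^ 2 / (∫ γ, F γ ∂P) ^ 2
        + (n : ℝ) / 2 * φ.normSq := by
  have hgrad := fun i => hP.integrable_and_integral_mul_paleyWiener (h_grad.hasLineDerivAt i)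
    hF_int (integrable_phiGradient_apply h_grad_int i)
  have hhess := hP.integrable_and_integral_mul_paleyWiener_mul hF_int h_grad h_grad_int h_hess
    h_hess_int
  have hpsd := posSemidef_covariance_of_weight hF_nonneg hF_int hF_pos
    (fun i => (hgrad i).1) (fun i j => (hhess i j).1)
  have hM : (Matrix.of fun i j => (∫ γ, F γ ∂P)⁻¹ *
        (∫ γ, F γ * φ.paleyWiener i γ * φ.paleyWiener j γ ∂P) -
      ((∫ γ, F γ ∂P) ^ 2)⁻¹ *
        ((∫ γ, F γ * φ.paleyWiener i γ ∂P) * (∫ γ, F γ * φ.paleyWiener j γ ∂P))) =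
      (∫ γ, F γ ∂P)⁻¹ • matrixExpectation P (phiHessian F φ)
        - ((∫ γ, F γ ∂P) ^ 2)⁻¹ •
            Matrix.vecMulVec (∫ γ, phiGradient F φ γ ∂P).ofLp (∫ γ, phiGradient F φ γ ∂P).ofLp
        + (φ.normSq / 2) • (1 : Matrix (Fin n) (Fin n) ℝ) := by
    ext i j
    simp only [Matrix.of_apply, Matrix.add_apply, Matrix.sub_apply, Matrix.smul_apply,
      Matrix.vecMulVec_apply, matrixExpectation, smul_eq_mul, Matrix.one_apply,
      integral_phiGradient_apply h_grad_int, (hhess i j).2, (hgrad i).2, (hgrad j).2]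
    have hm := hF_pos.ne'
    split_ifs
    · field_simp
      ring
    · ring
  have hpsd' := hM ▸ hpsd
  refine ⟨hpsd', ?_⟩
  have htr := hpsd'.trace_nonneg
  have e1 : (∫ γ, phiLaplacian F φ γ ∂P) = (matrixExpectation P (phiHessian F φ)).trace := by
    simp only [phiLaplacian, Matrix.trace, Matrix.diag, matrixExpectation, Matrix.of_apply]
    exact integral_finsetSum _ fun i _ => h_hess_int i i
  rw [Matrix.trace_add, Matrix.trace_sub, Matrix.trace_smul, Matrix.trace_smul, Matrix.trace_smul,
    Matrix.trace_one, Matrix.trace_vecMulVec, ← e1, Fintype.card_fin] at htr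
  rw [EuclideanSpace.real_norm_sq_eq]
  simp only [smul_eq_mul, dotProduct] at htr
  simp only [sq (_ : ℝ)] at htr ⊢
  refine htr.trans_eq ?_
  ring
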